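/- Let $\Phi:\mathbb{R}\to[0,\infty)$ be an Orlicz function, i.e. an even convex function with $\Phi(0)=0$, satisfying the $\Delta_2$-condition: there is a constant $K$ with $\Phi(2t)\le K\,\Phi(t)$ for all $t>0$. Then there is a constant $C_\Phi<\infty$, depending only on $\Phi$, such that the following holds for every $n\in\mathbb{N}$ and all independent random variables $f_1,\dots,f_n\in L_\Phi(0,1)$. Here $(0,1)$ carries Lebesgue measure, $\mathbb{E}(\Phi(g))=\int_0^1\Phi(g(s))\,ds$, and $g\in L_\Phi(0,1)$ means that the Lebesgue measurable function $g:(0,1)\to\mathbb{R}$ satisfies $\int_0^1\Phi(g(s)/\lambda)\,ds\le 1$ for some $\lambda>0$. Let $$f=\bigoplus_{k=1}^n f_k:=\sum_{k=1}^n f_k(\cdot-k+1)\,\chi_{[k-1,k)}$$ be their disjoint sum, a function on $(0,\infty)$ with Lebesgue measure, and let $$\mu(t,f)=\inf\{u\ge 0:\ |\{s>0:|f(s)|>u\}|<t\},\qquad t>0,$$ be the decreasing rearrangement of $|f|$. Write $X\approx_C Y$ if $X\le CY$ and $Y\le CX$. (i) If $f_k\ge 0$ almost everywhere for $1\le k\le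 n$, then $$\mathbb{E}\Big(\Phi\big(\sum_{k=1}^n f_k\big)\Big)\approx_{C_\Phi}\mathbb{E}\Big(\Phi\big(\mu(f)\chi_{(0,1)}\big)\Big)+\Phi\big(\|f\|_{L_1(0,\infty)}\big).$$ (ii) If every $f_k$, $1\le k\le n$, is symmetrically distributed (that is, $f_k$ and $-f_k$ have the same distribution), then $$\mathbb{E}\Big(\Phi\big(\sum_{k=1}^n f_k\big)\Big)\approx_{C_\Phi}\mathbb{E}\Big(\Phi\big(\mu(f)\chi_{(0,1)}\big)\Big)+\Phi\big(\|f\|_{L_1+L_2}\big),$$ where $\|f\|_{L_1+L_2}=\inf\{\|g\|_{L_1(0,\infty)}+\|h\|_{L_2(0,\infty)}:\ f=g+h,\ g\in L_1(0,\infty),\ h\in L_2(0,\infty)\}$. (The norms are finite unless $\Phi\equiv0$; in that degenerate case $\Phi(\infty)$ is read as $0$.) -/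

import Mathlib

open MeasureTheory ProbabilityTheory Set
open scoped ENNReal NNReal

noncomputable section

namespace PhiMoment

/-- An Orlicz function: an even convex function `Φ : ℝ → ℝ₊` with `Φ 0 = 0`. -/
structure IsOrlicz (Φ : ℝ → ℝ) : Prop where
  nonneg : ∀ t, 0 ≤ Φ t
  even : ∀ t, Φ (-t) = Φ t
  convex : ConvexOn ℝ univ Φ
  map_zero : Φ 0 = 0

/-- The `Δ₂`-condition: `Φ (2 t) ≤ C Φ t` for all `t > 0`. -/
def DeltaTwo (Φ : ℝ → ℝ) : Prop :=
  ∃ C : ℝ, ∀ t : ℝ, 0 < t → Φ (2 * t) ≤ C * Φ t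

/-- Lebesgue measure on the interval `(0, 1)`. -/
abbrev unitMeasure : Measure ℝ := volume.restrict (Ioo (0 : ℝ) 1)

/-- Lebesgue measure on the half-line `(0, ∞)`. -/
abbrev halfLineMeasure : Measure ℝ := volume.restrict (Ioi (0 : ℝ))

/-- The modular `E Φ(g) = ∫₀¹ Φ(g(s)) ds`, as an element of `[0, ∞]`. -/
def phiMoment (Φ : ℝ → ℝ) (g : ℝ → ℝ) : ℝ≥0∞ :=
  ∫⁻ s, ENNReal.ofReal (Φ (g s)) ∂unitMeasure

/-- The Luxemburg norm `inf {c > 0 : ∫ Φ(g / c) ≤ 1}`; it is `∞` if there is no such `c`. -/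
def luxemburgNorm (Φ : ℝ → ℝ) (g : ℝ → ℝ) (ν : Measure ℝ) : ℝ≥0∞ :=
  ⨅ (c : ℝ) (_ : 0 < c) (_ : ∫⁻ s, ENNReal.ofReal (Φ (g s / c)) ∂ν ≤ 1), ENNReal.ofReal c

/-- Membership in the Orlicz space `L_Φ(ν)`. For a real function and (a restriction of) Lebesgue
measure, `AEMeasurable` is the same as Lebesgue measurability. -/
def MemOrlicz (Φ : ℝ → ℝ) (g : ℝ → ℝ) (ν : Measure ℝ) : Prop :=
  AEMeasurable g ν ∧ luxemburgNorm Φ g ν < ∞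

/-- The disjoint sum of functions `f 0, …, f (n - 1)` on `(0, 1)`: the function on `(0, ∞)` that is
the translate of `f k` on `[k, k + 1)`, and zero on `[n, ∞)`. -/
def disjointSum {n : ℕ} (f : Fin n → ℝ → ℝ) (t : ℝ) : ℝ :=
  ∑ k : Fin n, (Ico (k : ℝ) ((k : ℝ) + 1)).indicator (fun s => f k (s - (k : ℝ))) t

/-- The decreasing rearrangement of `|g|`, for `g` a function on `(0, ∞)`, at `t > 0`:
`inf {u ≥ 0 : |{s > 0 : |g s| > u}| < t}`. -/
def rearrangement (g : ℝ → ℝ) (t : ℝ) : ℝ :=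
  sInf {u : ℝ | 0 ≤ u ∧ halfLineMeasure {s | u < |g s|} < ENNReal.ofReal t}

/-- The norm of `L₁ + L₂`: the infimum of `‖g₁‖₁ + ‖g₂‖₂` over all decompositions `g = g₁ + g₂`
(almost everywhere) with `g₁ ∈ L₁` and `g₂ ∈ L₂`; it is `∞` if there is none. -/
def sumNorm (g : ℝ → ℝ) (ν : Measure ℝ) : ℝ≥0∞ :=
  ⨅ (g₁ : ℝ → ℝ) (g₂ : ℝ → ℝ) (_ : MemLp g₁ 1 ν) (_ : MemLp g₂ 2 ν) (_ : g =ᵐ[ν] g₁ + g₂),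
    eLpNorm g₁ 1 ν + eLpNorm g₂ 2 ν

/-- `Φ` evaluated at a norm in `[0, ∞]`, with `Φ(∞) = sup Φ = lim_{t → ∞} Φ(t)`. -/
def extend (Φ : ℝ → ℝ) (x : ℝ≥0∞) : ℝ≥0∞ :=
  if x = ∞ then ⨆ t : ℝ, ENNReal.ofReal (Φ t) else ENNReal.ofReal (Φ x.toReal)

/-- `X ≈_C Y`, that is, `X ≤ C Y` and `Y ≤ C X`. -/
def EquivWith (C : ℝ≥0) (X Y : ℝ≥0∞) : Prop :=
  X ≤ C * Y ∧ Y ≤ C * X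

end PhiMoment

end

/-! By independence, everything is computed under the product of the laws `ν k` of the `f k`. The
disjoint sum enters only through `Λ = ∑ k, ν k`, which gives its distribution away from `0`. Let `a
= μ(1, f)`: at most one coordinate is expected to exceed `a` in modulus, and on `(0,1)` the tail of
`μ(f)` is the tail of `Λ` cut off at `1`.

Upper estimates. The `Δ₂`-condition gives `Φ (t * s) ≤ A * exp t * Φ s`, and exponentials factor
over independent coordinates. Each coordinate is truncated at `a`. The sum of the large parts is at
most their number times their maximum, and their number has a bounded exponential moment
(`lintegral_map_sum_large_le`). The sum of the small parts, divided by `r`, has a bounded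
exponential moment, where `r` is `a + ‖f‖₁` in the positive case and `a` plus the `L₂` norm of the
small part in the symmetric case (`lintegral_exp_small_le_of_integrable`,
`lintegral_exp_small_le_of_symm`). In both cases `r` is at most `2a` plus the relevant norm, and `Φ
a` is absorbed by the rearrangement term.

Lower estimates. The tail of the maximum of the coordinates controls that of `μ(f)` on `(0,1)`
(`min_tail_le`), and the maximum is dominated by the sum, pointwise or after averaging over signs.
Jensen's inequality handles `‖f‖₁`. For `L₁ + L₂`, it suffices to bound the norm by a multiple of
the mean of `|∑ x k|` (`sumNorm_le_of_symm`); the only delicate point is that the `L₂` norm of the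
small part is controlled by a first moment (`sqrt_sum_small_sq_le`). -/

namespace PhiMoment

/-! ### Orlicz functions: growth, Jensen's inequality, comparison of tails. -/

namespace IsOrlicz

variable {Φ : ℝ → ℝ}

lemma scale_le (h : IsOrlicz Φ) {c : ℝ} (hc : 0 ≤ c) (hc1 : c ≤ 1) (t : ℝ) :
    Φ (c * t) ≤ c * Φ t := by
  have := h.convex.2 (mem_univ t) (mem_univ 0) hc (by linarith : 0 ≤ 1 - c) (by ring)
  simpa [h.map_zero] using this

lemma map_abs (h : IsOrlicz Φ) (t : ℝ) : Φ |t| = Φ t := by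
  rcases abs_choice t with ht | ht <;> simp [ht, h.even]

lemma mono (h : IsOrlicz Φ) {s t : ℝ} (hst : |s| ≤ |t|) : Φ s ≤ Φ t := by
  rw [← h.map_abs s, ← h.map_abs t]
  rcases (abs_nonneg t).eq_or_lt with ht | ht
  · have : |s| = 0 := le_antisymm (by linarith) (abs_nonneg s)
    rw [this, ← ht]
  · have := h.scale_le (c := |s| / |t|) (by positivity) ((div_le_one ht).2 hst) |t|
    rw [div_mul_cancel₀ _ ht.ne'] at this
    exact this.trans (mul_le_of_le_one_left (h.nonneg _) ((div_le_one ht).2 hst))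

lemma lt_of_lt (h : IsOrlicz Φ) {s t : ℝ} (hs : 0 ≤ s) (hst : s < t) (hpos : 0 < Φ s) :
    Φ s < Φ t := by
  have ht : 0 < t := hs.trans_lt hst
  have h1 : s / t < 1 := (div_lt_one ht).2 hst
  have := h.scale_le (c := s / t) (by positivity) h1.le t
  rw [div_mul_cancel₀ _ ht.ne'] at this
  have h2 : 0 < Φ t := hpos.trans_le (h.mono (by rw [abs_of_nonneg hs, abs_of_pos ht]; exact hst.le))
  nlinarith

lemma continuous (h : IsOrlicz Φ) : Continuous Φ :=
  continuousOn_univ.1 (h.convex.continuousOn isOpen_univ)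

@[fun_prop]
lemma measurable (h : IsOrlicz Φ) : Measurable Φ := h.continuous.measurable

/-- Iterated doubling gives polynomial growth in `t`. It is weakened to an exponential because
exponentials of sums factor under independence. -/
lemma exists_growth (h : IsOrlicz Φ) (hΔ : DeltaTwo Φ) :
    ∃ A : ℝ, 0 ≤ A ∧ ∀ t : ℝ, 0 ≤ t → ∀ s, Φ (t * s) ≤ A * Real.exp t * Φ s := by
  obtain ⟨K, hK⟩ := hΔ
  obtain ⟨p, hp⟩ := pow_unbounded_of_one_lt K (one_lt_two : (1 : ℝ) < 2)
  have h2 : ∀ s, Φ (2 * s) ≤ 2 ^ p * Φ s := by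
    intro s
    rw [← h.map_abs (2 * s), ← h.map_abs s, abs_mul, abs_two]
    rcases (abs_nonneg s).eq_or_lt with hs | hs
    · simp [← hs, h.map_zero]
    · exact (hK _ hs).trans (mul_le_mul_of_nonneg_right hp.le (h.nonneg _))
  have hpow : ∀ (m : ℕ) s, Φ (2 ^ m * s) ≤ (2 ^ m) ^ p * Φ s := by
    intro m
    induction m with
    | zero => simp
    | succ m ih =>
      intro s
      have := (ih (2 * s)).trans (mul_le_mul_of_nonneg_left (h2 s) (by positivity))
      calc Φ (2 ^ (m + 1) * s) = Φ (2 ^ m * (2 * s)) := by ring_nf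
        _ ≤ _ := this
        _ = _ := by ring
  -- The constant comes from `(2 * (1 + t)) ^ p ≤ 2 ^ p * p! * exp (1 + t)`.
  refine ⟨2 ^ p * (p.factorial * Real.exp 1), by positivity, fun t ht s => ?_⟩
  obtain ⟨m, hm1, hm2⟩ : ∃ m : ℕ, t ≤ 2 ^ m ∧ (2 : ℝ) ^ m ≤ 2 * (1 + t) := by
    obtain ⟨m, hm, hm'⟩ := exists_nat_pow_near (x := 1 + t) (by linarith) (one_lt_two : (1 : ℝ) < 2)
    exact ⟨m + 1, by linarith, by rw [pow_succ]; linarith⟩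
  have h3 : (1 + t) ^ p ≤ p.factorial * (Real.exp 1 * Real.exp t) := by
    rw [← Real.exp_add]
    have := Real.pow_div_factorial_le_exp (1 + t) (by linarith) p
    rwa [div_le_iff₀' (by positivity)] at this
  calc Φ (t * s) ≤ Φ (2 ^ m * s) := h.mono (by
        rw [abs_mul, abs_mul, abs_of_nonneg ht, abs_of_nonneg (by positivity : (0 : ℝ) ≤ 2 ^ m)]
        gcongr)
    _ ≤ (2 ^ m) ^ p * Φ s := hpow m s
    _ ≤ (2 * (1 + t)) ^ p * Φ s :=
        mul_le_mul_of_nonneg_right (pow_le_pow_left₀ (by positivity) hm2 p) (h.nonneg _)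
    _ = 2 ^ p * (1 + t) ^ p * Φ s := by rw [mul_pow]
    _ ≤ 2 ^ p * (p.factorial * (Real.exp 1 * Real.exp t)) * Φ s :=
        mul_le_mul_of_nonneg_right (mul_le_mul_of_nonneg_left h3 (by positivity)) (h.nonneg _)
    _ = _ := by ring

lemma map_half_add_le (h : IsOrlicz Φ) {s p q : ℝ} (hs : p + q = 2 * s) :
    2 * Φ s ≤ Φ p + Φ q := by
  have := h.convex.2 (mem_univ p) (mem_univ q) (by norm_num : (0 : ℝ) ≤ 1 / 2)
    (by norm_num : (0 : ℝ) ≤ 1 / 2) (by norm_num)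
  have e : (1 / 2 : ℝ) • p + (1 / 2 : ℝ) • q = s := by
    simp only [smul_eq_mul]; linarith
  rw [e, smul_eq_mul, smul_eq_mul] at this
  linarith

lemma map_add_le (h : IsOrlicz Φ) {A : ℝ}
    (hA : ∀ t : ℝ, 0 ≤ t → ∀ s, Φ (t * s) ≤ A * Real.exp t * Φ s) (s t : ℝ) :
    Φ (s + t) ≤ A * Real.exp 2 * (Φ s + Φ t) := by
  have := h.map_half_add_le (s := s + t) (p := 2 * s) (q := 2 * t) (by ring)
  have h1 := hA 2 (by norm_num) s
  have h2 := hA 2 (by norm_num) t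
  have h3 := h.nonneg (2 * s)
  have h4 := h.nonneg (2 * t)
  linarith

/-- Beyond `|x₀|`, convexity keeps `Φ` above the line through the origin and `(|x₀|, Φ x₀)`. This
puts `L_Φ` of a finite measure inside `L₁`. -/
lemma abs_le_affine (h : IsOrlicz Φ) {x₀ : ℝ} (h0 : 0 < Φ x₀) (x : ℝ) :
    |x| ≤ |x₀| + |x₀| / Φ x₀ * Φ x := by
  have hn := h.nonneg x
  have hq : 0 ≤ |x₀| / Φ x₀ := by positivity
  rcases le_total |x| |x₀| with hx | hx
  · nlinarith [mul_nonneg hq hn]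
  · have hx0 : 0 < |x₀| := by
      rw [abs_pos]; rintro rfl; rw [h.map_zero] at h0; exact h0.false
    have hxp : 0 < |x| := hx0.trans_le hx
    have h1 := h.scale_le (c := |x₀| / |x|) (by positivity) ((div_le_one hxp).2 hx) |x|
    rw [div_mul_cancel₀ _ hxp.ne', h.map_abs, h.map_abs, div_mul_eq_mul_div,
      le_div_iff₀ hxp] at h1
    have : |x| ≤ |x₀| / Φ x₀ * Φ x := by
      rw [div_mul_eq_mul_div, le_div_iff₀ h0]; linarith
    linarith

lemma jensen (h : IsOrlicz Φ) {Ω : Type*} [MeasurableSpace Ω] {P : Measure Ω}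
    [IsProbabilityMeasure P] {X : Ω → ℝ} (hX : Integrable X P) :
    ENNReal.ofReal (Φ (∫ ω, X ω ∂P)) ≤ ∫⁻ ω, ENNReal.ofReal (Φ (X ω)) ∂P := by
  by_cases hi : Integrable (Φ ∘ X) P
  · have e := ofReal_integral_eq_lintegral_ofReal hi (.of_forall fun _ => h.nonneg _)
    simp only [Function.comp_apply] at e
    rw [← e]
    exact ENNReal.ofReal_le_ofReal (h.convex.map_integral_le h.continuous.continuousOn isClosed_univ
      (by simp) hX hi)
  · have hm : AEStronglyMeasurable (Φ ∘ X) P :=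
      h.continuous.comp_aestronglyMeasurable hX.aestronglyMeasurable
    have : ∫⁻ ω, ENNReal.ofReal (Φ (X ω)) ∂P = ∞ := by
      by_contra hne
      exact hi ⟨hm, (hasFiniteIntegral_iff_ofReal (.of_forall fun _ => h.nonneg _)).2
        (lt_top_iff_ne_top.2 hne)⟩
    simp [this]

lemma integrable_of_lintegral_lt_top (h : IsOrlicz Φ) (hne : ∃ x, 0 < Φ x)
    {Ω : Type*} [MeasurableSpace Ω] {P : Measure Ω} [IsFiniteMeasure P] {X : Ω → ℝ}
    (hX : AEMeasurable X P) (hfin : ∫⁻ ω, ENNReal.ofReal (Φ (X ω)) ∂P < ∞) : Integrable X P := by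
  obtain ⟨x₀, h0⟩ := hne
  have hi : Integrable (fun ω => Φ (X ω)) P :=
    ⟨(h.measurable.comp_aemeasurable hX).aestronglyMeasurable,
      (hasFiniteIntegral_iff_ofReal (.of_forall fun _ => h.nonneg _)).2 hfin⟩
  refine ((integrable_const |x₀|).add (hi.const_mul (|x₀| / Φ x₀))).mono' hX.aestronglyMeasurable
    (.of_forall fun ω => ?_)
  exact h.abs_le_affine h0 _

/-- Layer-cake formula: a level `t > 0` reached by `Φ` equals some `Φ u`, and `Φ` is strictly
increasing from there on, so `{Φ X > t}` is `{X > u}`. The constant stays outside `Φ`, so `Δ₂` is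
not needed. -/
lemma lintegral_le_of_tail_le (h : IsOrlicz Φ) {Ω₁ Ω₂ : Type*} [MeasurableSpace Ω₁]
    [MeasurableSpace Ω₂] {P₁ : Measure Ω₁} {P₂ : Measure Ω₂} {X : Ω₁ → ℝ} {Y : Ω₂ → ℝ}
    (hX : AEMeasurable X P₁) (hY : AEMeasurable Y P₂) (hX0 : ∀ ω, 0 ≤ X ω) (hY0 : ∀ ω, 0 ≤ Y ω)
    {C : ℝ≥0} (hle : ∀ u : ℝ, 0 ≤ u → P₁ {ω | u < X ω} ≤ C * P₂ {ω | u < Y ω}) :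
    ∫⁻ ω, ENNReal.ofReal (Φ (X ω)) ∂P₁ ≤ C * ∫⁻ ω, ENNReal.ofReal (Φ (Y ω)) ∂P₂ := by
  rw [lintegral_eq_lintegral_meas_lt P₁ (.of_forall fun _ => h.nonneg _)
      (h.measurable.comp_aemeasurable hX),
    lintegral_eq_lintegral_meas_lt P₂ (.of_forall fun _ => h.nonneg _)
      (h.measurable.comp_aemeasurable hY), ← lintegral_const_mul' _ _ ENNReal.coe_ne_top]
  refine setLIntegral_mono' measurableSet_Ioi fun t (ht : 0 < t) => ?_
  by_cases hv : ∃ v, 0 ≤ v ∧ t ≤ Φ v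
  · obtain ⟨v, hv0, hv⟩ := hv
    obtain ⟨u, ⟨hu0, -⟩, rfl⟩ := intermediate_value_Icc hv0 h.continuous.continuousOn
      (⟨by rw [h.map_zero]; exact ht.le, hv⟩ : t ∈ Icc (Φ 0) (Φ v))
    have key : ∀ x, 0 ≤ x → (Φ u < Φ x ↔ u < x) := by
      refine fun x hx => ⟨fun hlt => ?_, fun hlt => h.lt_of_lt hu0 hlt ht⟩
      by_contra! hxu
      exact hlt.not_ge (h.mono (by rwa [abs_of_nonneg hx, abs_of_nonneg hu0]))
    simpa only [key _ (hX0 _), key _ (hY0 _)] using hle u hu0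
  · push Not at hv
    have : {ω | t < Φ (X ω)} = ∅ := by
      ext ω
      simpa using (hv _ (hX0 ω)).le
    simp [this]

end IsOrlicz

lemma isOrlicz_abs : IsOrlicz (fun t : ℝ => |t|) where
  nonneg := abs_nonneg
  even := abs_neg
  convex := (convexOn_univ_norm (E := ℝ) : ConvexOn ℝ univ (fun t : ℝ => ‖t‖))
  map_zero := abs_zero

instance : IsProbabilityMeasure unitMeasure := ⟨by simp [unitMeasure]⟩

/-- The part of `x` that exceeds the level `a`. -/
noncomputable def large (a x : ℝ) : ℝ := if a < |x| then x else 0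

/-- The part of `x` below the level `a`. -/
noncomputable def small (a x : ℝ) : ℝ := if |x| ≤ a then x else 0

@[fun_prop]
lemma measurable_large (a : ℝ) : Measurable (large a) :=
  Measurable.ite (measurableSet_lt measurable_const measurable_id.abs) measurable_id
    measurable_const

@[fun_prop]
lemma measurable_small (a : ℝ) : Measurable (small a) :=
  Measurable.ite (measurableSet_le measurable_id.abs measurable_const) measurable_id
    measurable_const

lemma small_add_large (a x : ℝ) : small a x + large a x = x := by
  unfold small large
  rcases le_or_gt |x| a with h | h
  · simp [h, h.not_gt]
  · simp [h, h.not_ge]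

lemma abs_small_le {a : ℝ} (ha : 0 ≤ a) (x : ℝ) : |small a x| ≤ a := by
  unfold small; split_ifs <;> simp_all

lemma abs_small_le_abs (a x : ℝ) : |small a x| ≤ |x| := by
  unfold small; split_ifs <;> simp

lemma small_neg (a x : ℝ) : small a (-x) = -small a x := by
  unfold small; split_ifs <;> simp_all

/-! ### The rearrangement and its tails, in terms of a finite measure `Λ` carrying the distribution.
-/

section Rearrangement

variable {g : ℝ → ℝ} {Λ : Measure ℝ}

lemma rearrangement_nonneg (g : ℝ → ℝ) (t : ℝ) : 0 ≤ rearrangement g t :=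
  Real.sInf_nonneg fun _ hu => hu.1

lemma rearrangement_le {t u : ℝ} (hu : 0 ≤ u)
    (h : halfLineMeasure {s | u < |g s|} < ENNReal.ofReal t) : rearrangement g t ≤ u :=
  csInf_le ⟨0, fun _ hv => hv.1⟩ ⟨hu, h⟩

lemma exists_tail_lt [IsFiniteMeasure Λ] {ε : ℝ≥0∞} (hε : 0 < ε) :
    ∃ u : ℝ, 0 ≤ u ∧ Λ {x | u < |x|} < ε := by
  have hanti : Antitone fun n : ℕ => {x : ℝ | (n : ℝ) < |x|} := fun m n hmn x (hx : (n : ℝ) < |x|) =>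
    lt_of_le_of_lt (Nat.cast_le.2 hmn) hx
  have hm (n : ℕ) : MeasurableSet {x : ℝ | (n : ℝ) < |x|} :=
    measurableSet_lt measurable_const measurable_id.abs
  have hlim := tendsto_measure_iInter_atTop (μ := Λ) (fun n => (hm n).nullMeasurableSet) hanti
    ⟨0, measure_ne_top _ _⟩
  have hempty : (⋂ n : ℕ, {x : ℝ | (n : ℝ) < |x|}) = ∅ := by
    ext x
    obtain ⟨n, hn⟩ := exists_nat_ge |x|
    simpa using ⟨n, hn⟩
  rw [hempty, measure_empty] at hlim
  obtain ⟨n, hn⟩ := (hlim.eventually (gt_mem_nhds hε)).exists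
  exact ⟨n, n.cast_nonneg, hn⟩

/-- The tail is right-continuous in `u`, so it still exceeds `t` slightly above `u`; this margin
makes the conclusion strict. -/
lemma lt_rearrangement [IsFiniteMeasure Λ]
    (hd : ∀ u : ℝ, 0 ≤ u → halfLineMeasure {s | u < |g s|} = Λ {x | u < |x|})
    {t u : ℝ} (ht : 0 < t) (h : ENNReal.ofReal t < Λ {x | u < |x|}) :
    u < rearrangement g t := by
  have hmono : Monotone fun n : ℕ => {x : ℝ | u + 1 / ((n : ℝ) + 1) < |x|} := by
    intro m n hmn x (hx : u + 1 / ((m : ℝ) + 1) < |x|)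
    exact lt_of_le_of_lt (by gcongr) hx
  have hun : {x : ℝ | u < |x|} = ⋃ n : ℕ, {x : ℝ | u + 1 / ((n : ℝ) + 1) < |x|} := by
    ext x
    simp only [mem_ofPred_eq, mem_iUnion]
    refine ⟨fun hx => ?_, fun ⟨n, hn⟩ => ?_⟩
    · obtain ⟨n, hn⟩ := exists_nat_one_div_lt (sub_pos.2 hx)
      exact ⟨n, by linarith⟩
    · have : 0 < 1 / ((n : ℝ) + 1) := by positivity
      linarith
  rw [hun, hmono.measure_iUnion, lt_iSup_iff] at h
  obtain ⟨n, hn⟩ := h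
  have hpos : 0 < 1 / ((n : ℝ) + 1) := by positivity
  have : u + 1 / ((n : ℝ) + 1) ≤ rearrangement g t := by
    obtain ⟨v, hv0, hv⟩ := exists_tail_lt (Λ := Λ) (ENNReal.ofReal_pos.2 ht)
    refine le_csInf ⟨v, hv0, by rwa [hd v hv0]⟩ fun w hw => ?_
    by_contra! hlt
    have h1 : Λ {x : ℝ | u + 1 / ((n : ℝ) + 1) < |x|} ≤ Λ {x | w < |x|} :=
      measure_mono fun x (hx : u + 1 / ((n : ℝ) + 1) < |x|) => hlt.trans hx
    have h2 := hw.2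
    rw [hd w hw.1] at h2
    exact (hn.trans_le h1).not_gt h2
  linarith

lemma antitoneOn_rearrangement [IsFiniteMeasure Λ]
    (hd : ∀ u : ℝ, 0 ≤ u → halfLineMeasure {s | u < |g s|} = Λ {x | u < |x|}) :
    AntitoneOn (rearrangement g) (Ioi 0) := by
  intro s (hs : 0 < s) t _ hst
  -- The set of levels must be nonempty: a real infimum over `∅` is `0`, which would break
  -- monotonicity.
  obtain ⟨v, hv0, hv⟩ := exists_tail_lt (Λ := Λ) (ENNReal.ofReal_pos.2 hs)
  refine csInf_le_csInf ⟨0, fun _ hv => hv.1⟩ ⟨v, hv0, by rwa [hd v hv0]⟩ fun w hw => ?_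
  exact ⟨hw.1, hw.2.trans_le (ENNReal.ofReal_le_ofReal hst)⟩

lemma aemeasurable_rearrangement [IsFiniteMeasure Λ]
    (hd : ∀ u : ℝ, 0 ≤ u → halfLineMeasure {s | u < |g s|} = Λ {x | u < |x|}) :
    AEMeasurable (rearrangement g) unitMeasure :=
  aemeasurable_restrict_of_antitoneOn measurableSet_Ioo
    ((antitoneOn_rearrangement hd).mono fun _ hx => hx.1)

lemma unitMeasure_lt_rearrangement [IsFiniteMeasure Λ]
    (hd : ∀ u : ℝ, 0 ≤ u → halfLineMeasure {s | u < |g s|} = Λ {x | u < |x|})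
    {u : ℝ} (hu : 0 ≤ u) :
    unitMeasure {t | u < rearrangement g t} = min (Λ {x | u < |x|}) 1 := by
  apply le_antisymm
  · refine le_min ?_ prob_le_one
    rw [unitMeasure, Measure.restrict_apply' measurableSet_Ioo]
    calc volume ({t | u < rearrangement g t} ∩ Ioo 0 1)
        ≤ volume (Ioc 0 (Λ {x | u < |x|}).toReal) := by
          refine measure_mono fun t ⟨ht, ht0, _⟩ => ⟨ht0, ?_⟩
          by_contra! hlt
          refine (lt_of_lt_of_le ht (rearrangement_le hu ?_)).false
          rw [hd u hu]
          exact (ENNReal.lt_ofReal_iff_toReal_lt (measure_ne_top _ _)).2 hlt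
      _ = _ := by simp
  · rw [unitMeasure, Measure.restrict_apply' measurableSet_Ioo]
    calc min (Λ {x | u < |x|}) 1 = volume (Ioo 0 (min (Λ {x | u < |x|}) 1).toReal) := by
          rw [Real.volume_Ioo, sub_zero, ENNReal.ofReal_toReal]
          exact ne_top_of_le_ne_top ENNReal.one_ne_top (min_le_right _ _)
      _ ≤ _ := by
          refine measure_mono fun t ⟨ht0, ht⟩ => ?_
          have h1 : ENNReal.ofReal t < min (Λ {x | u < |x|}) 1 :=
            (ENNReal.ofReal_lt_iff_lt_toReal ht0.le
              (ne_top_of_le_ne_top ENNReal.one_ne_top (min_le_right _ _))).2 ht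
          refine ⟨lt_rearrangement hd ht0 (h1.trans_le (min_le_left _ _)), ht0, ?_⟩
          simpa using h1.trans_le (min_le_right _ _)

lemma tail_rearrangement_one_le [IsFiniteMeasure Λ]
    (hd : ∀ u : ℝ, 0 ≤ u → halfLineMeasure {s | u < |g s|} = Λ {x | u < |x|}) :
    Λ {x | rearrangement g 1 < |x|} ≤ 1 := by
  by_contra! h
  exact (lt_rearrangement hd one_pos (by simpa using h)).false

lemma phiMoment_indicator (Φ : ℝ → ℝ) (g : ℝ → ℝ) :
    phiMoment Φ ((Ioo (0 : ℝ) 1).indicator g) = phiMoment Φ g :=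
  setLIntegral_congr_fun measurableSet_Ioo fun t ht => by simp [indicator_of_mem ht]

variable {Φ : ℝ → ℝ}

lemma map_rearrangement_one_le [IsFiniteMeasure Λ] (h : IsOrlicz Φ)
    (hd : ∀ u : ℝ, 0 ≤ u → halfLineMeasure {s | u < |g s|} = Λ {x | u < |x|}) :
    ENNReal.ofReal (Φ (rearrangement g 1)) ≤ phiMoment Φ (rearrangement g) := by
  calc ENNReal.ofReal (Φ (rearrangement g 1))
      = ∫⁻ _, ENNReal.ofReal (Φ (rearrangement g 1)) ∂unitMeasure := by simp
    _ ≤ _ := setLIntegral_mono' measurableSet_Ioo fun t ht => ENNReal.ofReal_le_ofReal (h.mono (by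
        rw [abs_of_nonneg (rearrangement_nonneg _ _), abs_of_nonneg (rearrangement_nonneg _ _)]
        exact antitoneOn_rearrangement hd ht.1 (mem_Ioi.2 one_pos) ht.2.le))

/-- The tail of the large part is at most that of `Λ`, and at most `1` because it lives on `{|x| >
μ(1, g)}`. This is exactly the cut-off tail of the rearrangement on `(0,1)`. -/
lemma lintegral_large_le [IsFiniteMeasure Λ] (h : IsOrlicz Φ)
    (hd : ∀ u : ℝ, 0 ≤ u → halfLineMeasure {s | u < |g s|} = Λ {x | u < |x|}) :
    ∫⁻ x, ENNReal.ofReal (Φ (large (rearrangement g 1) x)) ∂Λ ≤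
      phiMoment Φ (rearrangement g) := by
  set a := rearrangement g 1
  have ha : 0 ≤ a := rearrangement_nonneg g 1
  have := h.lintegral_le_of_tail_le (P₁ := Λ) (P₂ := unitMeasure)
    (X := fun x => |large a x|) (Y := rearrangement g) (C := 1)
    (by fun_prop) (aemeasurable_rearrangement hd) (fun _ => abs_nonneg _)
    (rearrangement_nonneg g) (fun u hu => ?_)
  · simpa [h.map_abs, phiMoment] using this
  · rw [unitMeasure_lt_rearrangement hd hu, ENNReal.coe_one, one_mul]
    refine le_min (measure_mono fun x (hx : u < |large a x|) => ?_)
      ((measure_mono fun x (hx : u < |large a x|) => ?_).trans (tail_rearrangement_one_le hd))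
    · unfold large at hx
      split_ifs at hx
      · exact hx
      · simp at hx; linarith
    · unfold large at hx
      split_ifs at hx with h1
      · exact h1
      · simp at hx; linarith

end Rearrangement

/-! ### The disjoint sum and the sum of the laws. -/

section DisjointSum

variable {n : ℕ} {f : Fin n → ℝ → ℝ}

lemma lintegral_translate (k : ℕ) (G : ℝ → ℝ≥0∞) :
    ∫⁻ t in Ico (k : ℝ) (k + 1), G (t - k) ∂halfLineMeasure = ∫⁻ s, G s ∂unitMeasure := by
  have hk : (0 : ℝ) ≤ k := k.cast_nonneg
  have h1 : (volume.restrict (Ioi (0 : ℝ))).restrict (Ico (k : ℝ) (k + 1)) =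
      volume.restrict (Ioo (k : ℝ) (k + 1)) := by
    rw [Measure.restrict_restrict measurableSet_Ico]
    refine Measure.restrict_congr_set ?_
    refine ((Ioo_ae_eq_Ico (a := (k : ℝ)) (b := k + 1)).symm.inter (ae_eq_refl (Ioi 0))).trans ?_
    have e : Ioo (k : ℝ) (k + 1) ∩ Ioi 0 = Ioo (k : ℝ) (k + 1) :=
      inter_eq_left.2 fun x hx => hk.trans_lt hx.1
    exact Filter.EventuallyEq.of_eq e
  have h2 : (fun t : ℝ => t - k) ⁻¹' Ioo 0 1 = Ioo (k : ℝ) (k + 1) := by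
    ext x; simp [add_comm]
  rw [halfLineMeasure, h1, ← h2]
  exact (measurePreserving_sub_right volume (k : ℝ)).setLIntegral_comp_preimage_emb
    (MeasurableEquiv.subRight (k : ℝ)).measurableEmbedding G _

/-- At most one half-open interval contains `t`, so `F` passes through the sum, and `F 0 = 0` covers
the points outside all of them. -/
lemma map_disjointSum {β : Type*} [AddCommMonoid β] (F : ℝ → β) (hF : F 0 = 0)
    (f : Fin n → ℝ → ℝ) (t : ℝ) :
    F (disjointSum f t) =
      ∑ k : Fin n, (Ico (k : ℝ) ((k : ℝ) + 1)).indicator (fun s => F (f k (s - k))) t := by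
  unfold disjointSum
  by_cases h : ∃ k : Fin n, t ∈ Ico (k : ℝ) ((k : ℝ) + 1)
  · obtain ⟨k, hk⟩ := h
    have hne : ∀ j : Fin n, j ≠ k → t ∉ Ico (j : ℝ) ((j : ℝ) + 1) := by
      intro j hjk hj
      apply hjk
      have h1 : ((j : ℕ) : ℝ) < (k : ℕ) + 1 := hj.1.trans_lt hk.2
      have h2 : ((k : ℕ) : ℝ) < (j : ℕ) + 1 := hk.1.trans_lt hj.2
      norm_cast at h1 h2
      exact Fin.ext (by omega)
    rw [Finset.sum_eq_single k (fun j _ hj => indicator_of_notMem (hne j hj) _) (by simp),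
      Finset.sum_eq_single k (fun j _ hj => indicator_of_notMem (hne j hj) _) (by simp),
      indicator_of_mem hk, indicator_of_mem hk]
  · push Not at h
    rw [Finset.sum_eq_zero fun j _ => indicator_of_notMem (h j) _,
      Finset.sum_eq_zero fun j _ => indicator_of_notMem (h j) _, hF]

lemma aemeasurable_translate {h : ℝ → ℝ} (hh : AEMeasurable h unitMeasure) (k : ℕ) :
    AEMeasurable (fun t => h (t - k)) (halfLineMeasure.restrict (Ico (k : ℝ) (k + 1))) := by
  have hm : Measurable fun t : ℝ => t - k := by fun_prop
  refine hh.comp_quasiMeasurePreserving (MeasurePreserving.quasiMeasurePreserving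
    ⟨hm, ?_⟩)
  ext s hs
  rw [Measure.map_apply hm hs, ← lintegral_indicator_one hs,
    ← lintegral_indicator_one (hm hs)]
  exact lintegral_translate k (s.indicator 1)

lemma aemeasurable_disjointSum (hf : ∀ k, AEMeasurable (f k) unitMeasure) :
    AEMeasurable (disjointSum f) halfLineMeasure := by
  unfold disjointSum
  exact Finset.aemeasurable_fun_sum _ fun k _ =>
    (aemeasurable_indicator_iff measurableSet_Ico).2 (aemeasurable_translate (hf k) k)

lemma lintegral_disjointSum (hf : ∀ k, AEMeasurable (f k) unitMeasure) {F : ℝ → ℝ≥0∞}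
    (hF : Measurable F) (hF0 : F 0 = 0) :
    ∫⁻ t, F (disjointSum f t) ∂halfLineMeasure = ∫⁻ x, F x ∂(∑ k, unitMeasure.map (f k)) := by
  simp_rw [map_disjointSum F hF0 f]
  rw [lintegral_finsetSum', lintegral_finsetSum_measure]
  · refine Finset.sum_congr rfl fun k _ => ?_
    rw [lintegral_indicator measurableSet_Ico, lintegral_map' hF.aemeasurable (hf k)]
    exact lintegral_translate k fun s => F (f k s)
  · exact fun k _ => (aemeasurable_indicator_iff measurableSet_Ico).2
      (hF.comp_aemeasurable (aemeasurable_translate (hf k) k))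

lemma halfLineMeasure_lt_abs_disjointSum (hf : ∀ k, AEMeasurable (f k) unitMeasure)
    {u : ℝ} (hu : 0 ≤ u) :
    halfLineMeasure {s | u < |disjointSum f s|} =
      (∑ k, unitMeasure.map (f k)) {x | u < |x|} := by
  have hm : MeasurableSet {x : ℝ | u < |x|} := measurableSet_lt measurable_const measurable_id.abs
  have := lintegral_disjointSum hf (F := {x : ℝ | u < |x|}.indicator 1)
    (measurable_one.indicator hm) (by simp [hu])
  rw [lintegral_indicator_one hm] at this
  rw [← this, ← lintegral_indicator_one₀]
  · rfl
  · exact (aemeasurable_disjointSum hf).nullMeasurable hm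

end DisjointSum

/-! ### Upper estimates for sums of independent coordinates. -/

lemma one_add_ofReal_le_ofReal_exp {r : ℝ} (hr : 0 ≤ r) :
    1 + ENNReal.ofReal r ≤ ENNReal.ofReal (Real.exp r) := by
  rw [← ENNReal.ofReal_one, ← ENNReal.ofReal_add zero_le_one hr]
  exact ENNReal.ofReal_le_ofReal (by linarith [Real.add_one_le_exp r])

lemma exp_le_one_add_add_sq {x : ℝ} (hx : |x| ≤ 1) : Real.exp x ≤ 1 + x + x ^ 2 := by
  have := (abs_le.1 (Real.abs_exp_sub_one_sub_id_le hx)).2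
  linarith

lemma exists_abs_eq_norm {n : ℕ} [NeZero n] (x : Fin n → ℝ) : ∃ i, |x i| = ‖x‖ := by
  obtain ⟨i, -, hi⟩ := Finset.exists_max_image Finset.univ (fun i => |x i|) ⟨0, Finset.mem_univ _⟩
  exact ⟨i, le_antisymm (norm_le_pi_norm x i)
    ((pi_norm_le_iff_of_nonneg (abs_nonneg _)).2 fun j => hi j (Finset.mem_univ j))⟩

lemma IsOrlicz.map_norm_le_sum {Φ : ℝ → ℝ} (h : IsOrlicz Φ) {n : ℕ} (x : Fin n → ℝ) :
    Φ ‖x‖ ≤ ∑ k, Φ (x k) := by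
  rcases Nat.eq_zero_or_pos n with rfl | hn
  · rw [Subsingleton.elim x 0, norm_zero, h.map_zero]; simp
  · have : NeZero n := ⟨hn.ne'⟩
    obtain ⟨i, hi⟩ := exists_abs_eq_norm x
    rw [← hi, h.map_abs]
    exact Finset.single_le_sum (f := fun k => Φ (x k)) (fun k _ => h.nonneg _) (Finset.mem_univ i)

/-- With `S` the sum, write `|S| = (|S| / r) * r` and apply the growth bound with `t = |S| / r`. -/
lemma lintegral_map_sum_le_of_exp {Φ : ℝ → ℝ} (h : IsOrlicz Φ) {A : ℝ} (hA0 : 0 ≤ A)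
    (hA : ∀ t : ℝ, 0 ≤ t → ∀ s, Φ (t * s) ≤ A * Real.exp t * Φ s)
    {n : ℕ} {P : Measure (Fin n → ℝ)} {φ : ℝ → ℝ} {r B : ℝ} (hr : 0 < r)
    (hexp : ∫⁻ x, ENNReal.ofReal (Real.exp |∑ k, r⁻¹ * φ (x k)|) ∂P ≤
      ENNReal.ofReal B) :
    ∫⁻ x, ENNReal.ofReal (Φ (∑ k, φ (x k))) ∂P ≤
      ENNReal.ofReal (A * B) * ENNReal.ofReal (Φ r) := by
  calc _ ≤ ∫⁻ x, ENNReal.ofReal (A * Φ r) *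
        ENNReal.ofReal (Real.exp |∑ k, r⁻¹ * φ (x k)|) ∂P := by
        refine lintegral_mono fun x => ?_
        rw [← ENNReal.ofReal_mul (mul_nonneg hA0 (h.nonneg _))]
        refine ENNReal.ofReal_le_ofReal ?_
        have := hA |∑ k, r⁻¹ * φ (x k)| (abs_nonneg _) r
        have e : |(|∑ k, r⁻¹ * φ (x k)| * r)| = |∑ k, φ (x k)| := by
          rw [← Finset.mul_sum, abs_mul, abs_abs, abs_mul, abs_of_pos hr, abs_of_pos (inv_pos.2 hr)]
          field_simp
        rw [← h.map_abs (∑ k, φ (x k)), ← e, h.map_abs]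
        linarith
    _ ≤ ENNReal.ofReal (A * Φ r) * ENNReal.ofReal B := by
        rw [lintegral_const_mul' _ _ ENNReal.ofReal_ne_top]
        gcongr
    _ = _ := by
        rw [ENNReal.ofReal_mul hA0, ENNReal.ofReal_mul hA0]
        ring

lemma integral_small_eq_zero {P : Measure ℝ} (hs : P.map (fun y => -y) = P) (a : ℝ) :
    ∫ y, small a y ∂P = 0 := by
  have h : ∫ y, small a y ∂P = -∫ y, small a y ∂P := by
    conv_lhs => rw [← hs, integral_map (by fun_prop) (by fun_prop)]
    simp only [small_neg, integral_neg]
  linarith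

variable {n : ℕ} {ν : Fin n → Measure ℝ} [∀ k, IsProbabilityMeasure (ν k)]

lemma lintegral_pi_eval (k : Fin n) {F : ℝ → ℝ≥0∞} (hF : Measurable F) :
    ∫⁻ x, F (x k) ∂Measure.pi ν = ∫⁻ y, F y ∂ν k :=
  (measurePreserving_eval ν k).lintegral_comp hF

lemma lintegral_pi_prod {F : Fin n → ℝ → ℝ≥0∞} (hF : ∀ k, Measurable (F k)) :
    ∫⁻ x, ∏ k, F k (x k) ∂Measure.pi ν = ∏ k, ∫⁻ y, F k y ∂ν k := by
  have hi := iIndepFun_pi (μ := ν) (X := F) fun k => (hF k).aemeasurable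
  rw [lintegral_prod_eq_prod_lintegral_of_indepFun Finset.univ _ hi
    fun k => (hF k).comp (measurable_pi_apply k)]
  exact Finset.prod_congr rfl fun k _ => lintegral_pi_eval k (hF k)

lemma lintegral_exp_sum_le {φ : ℝ → ℝ} (hφ : Measurable φ) {b : Fin n → ℝ}
    (hle : ∀ k, ∫⁻ y, ENNReal.ofReal (Real.exp (φ y)) ∂ν k ≤ ENNReal.ofReal (1 + b k)) :
    ∫⁻ x, ENNReal.ofReal (Real.exp (∑ k, φ (x k))) ∂Measure.pi ν ≤
      ENNReal.ofReal (Real.exp (∑ k, b k)) := by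
  simp_rw [Real.exp_sum]
  simp_rw [ENNReal.ofReal_prod_of_nonneg fun (k : Fin n) _ => (Real.exp_pos _).le]
  rw [lintegral_pi_prod (F := fun _ y => ENNReal.ofReal (Real.exp (φ y))) fun _ => by fun_prop]
  refine Finset.prod_le_prod' fun k _ => (hle k).trans (ENNReal.ofReal_le_ofReal ?_)
  linarith [Real.add_one_le_exp (b k)]

lemma lintegral_exp_abs_sum_le {φ : ℝ → ℝ} (hφ : Measurable φ) {b : Fin n → ℝ}
    (hle : ∀ k, ∫⁻ y, ENNReal.ofReal (Real.exp (φ y)) ∂ν k ≤ ENNReal.ofReal (1 + b k))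
    (hle' : ∀ k, ∫⁻ y, ENNReal.ofReal (Real.exp (-φ y)) ∂ν k ≤ ENNReal.ofReal (1 + b k)) :
    ∫⁻ x, ENNReal.ofReal (Real.exp |∑ k, φ (x k)|) ∂Measure.pi ν ≤
      ENNReal.ofReal (2 * Real.exp (∑ k, b k)) := by
  have h1 := lintegral_exp_sum_le hφ hle
  have h2 := lintegral_exp_sum_le hφ.neg hle'
  simp only [Pi.neg_apply, Finset.sum_neg_distrib] at h2
  calc _ ≤ ∫⁻ x, (ENNReal.ofReal (Real.exp (∑ k, φ (x k))) +
        ENNReal.ofReal (Real.exp (-∑ k, φ (x k)))) ∂Measure.pi ν := by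
        refine lintegral_mono fun x => ?_
        rcases abs_choice (∑ k, φ (x k)) with h | h
        · simp only [h]; exact le_self_add
        · simp only [h]; exact le_add_self
    _ ≤ _ := by
        rw [lintegral_add_left (by fun_prop), two_mul, ENNReal.ofReal_add (by positivity)
          (by positivity)]
        exact add_le_add h1 h2

/-- The sum is at most the number of large coordinates times their maximum; growth is applied with
`t` that number, and `Φ` of the maximum is at most the sum of the `Φ` values. -/
lemma map_sum_large_le {Φ : ℝ → ℝ} (h : IsOrlicz Φ) {A : ℝ} (hA0 : 0 ≤ A)
    (hA : ∀ t : ℝ, 0 ≤ t → ∀ s, Φ (t * s) ≤ A * Real.exp t * Φ s) (a : ℝ) (x : Fin n → ℝ) :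
    Φ (∑ k, large a (x k)) ≤ A * Real.exp (∑ k, {y : ℝ | a < |y|}.indicator 1 (x k)) *
      ∑ k, Φ (large a (x k)) := by
  set l : Fin n → ℝ := fun k => large a (x k)
  have hN : 0 ≤ ∑ k, {y : ℝ | a < |y|}.indicator (1 : ℝ → ℝ) (x k) :=
    Finset.sum_nonneg fun k _ => indicator_nonneg (fun _ _ => zero_le_one) _
  have h1 : |∑ k, l k| ≤ |(∑ k, {y : ℝ | a < |y|}.indicator (1 : ℝ → ℝ) (x k)) * ‖l‖| := by
    rw [abs_of_nonneg (mul_nonneg hN (norm_nonneg _)), Finset.sum_mul]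
    refine (Finset.abs_sum_le_sum_abs _ _).trans (Finset.sum_le_sum fun k _ => ?_)
    by_cases hk : a < |x k|
    · rw [indicator_of_mem (by exact hk)]
      simpa using norm_le_pi_norm l k
    · simp [l, large, hk]
  calc _ ≤ _ := h.mono h1
    _ ≤ _ := hA _ hN _
    _ ≤ _ := mul_le_mul_of_nonneg_left (h.map_norm_le_sum l) (by positivity)

lemma lintegral_exp_indicator_le (k : Fin n) (a : ℝ) :
    ∫⁻ y, ENNReal.ofReal (Real.exp ({y : ℝ | a < |y|}.indicator 1 y)) ∂ν k ≤
      ENNReal.ofReal (Real.exp (2 * (ν k {y | a < |y|}).toReal)) := by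
  have hm : MeasurableSet {y : ℝ | a < |y|} := measurableSet_lt measurable_const measurable_id.abs
  calc _ ≤ ∫⁻ y, (1 + 2 * {y : ℝ | a < |y|}.indicator 1 y) ∂ν k := by
        refine lintegral_mono fun y => ?_
        by_cases hy : y ∈ {y : ℝ | a < |y|}
        · have : (1 : ℝ≥0∞) + 2 * 1 = ENNReal.ofReal 3 := by
            rw [mul_one]; norm_num
          simp only [indicator_of_mem hy, Pi.one_apply, this]
          exact ENNReal.ofReal_le_ofReal (by linarith [Real.exp_one_lt_d9])
        · simp [indicator_of_notMem hy]
    _ = 1 + ENNReal.ofReal (2 * (ν k {y | a < |y|}).toReal) := by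
        rw [lintegral_add_left measurable_const, lintegral_const_mul' _ _ (by simp),
          lintegral_indicator_one hm, ENNReal.ofReal_mul (by norm_num),
          ENNReal.ofReal_toReal (measure_ne_top _ _)]
        simp
    _ ≤ _ := one_add_ofReal_le_ofReal_exp (by positivity)

/-- The integrand is a product over coordinates. In `exp 3`, one factor `exp 1` bounds the `k`-th
indicator pointwise, and `exp 2` bounds the remaining factors since the probabilities add up to at
most `1`. -/
lemma lintegral_exp_count_mul_le {a : ℝ} (ha : (∑ k, ν k) {y | a < |y|} ≤ 1) (k : Fin n)
    {F : ℝ → ℝ≥0∞} (hF : Measurable F) :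
    ∫⁻ x, ENNReal.ofReal (Real.exp (∑ j, {y : ℝ | a < |y|}.indicator 1 (x j))) * F (x k)
      ∂Measure.pi ν ≤ ENNReal.ofReal (Real.exp 3) * ∫⁻ y, F y ∂ν k := by
  have hm : MeasurableSet {y : ℝ | a < |y|} := measurableSet_lt measurable_const measurable_id.abs
  have hind : Measurable ({y : ℝ | a < |y|}.indicator (1 : ℝ → ℝ)) := measurable_one.indicator hm
  set G : Fin n → ℝ → ℝ≥0∞ := fun j y =>
    ENNReal.ofReal (Real.exp ({y : ℝ | a < |y|}.indicator 1 y)) * (if j = k then F y else 1)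
  have hG : ∀ j, Measurable (G j) := by
    intro j
    refine Measurable.mul (by fun_prop) ?_
    split_ifs
    · exact hF
    · exact measurable_const
  have e : ∀ x : Fin n → ℝ,
      ENNReal.ofReal (Real.exp (∑ j, {y : ℝ | a < |y|}.indicator 1 (x j))) * F (x k) =
        ∏ j, G j (x j) := by
    intro x
    rw [Finset.prod_mul_distrib, Finset.prod_ite_eq' Finset.univ k, if_pos (Finset.mem_univ k),
      Real.exp_sum, ENNReal.ofReal_prod_of_nonneg fun _ _ => (Real.exp_pos _).le]
  simp_rw [e]
  rw [lintegral_pi_prod hG]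
  have hone : ∀ y, {y : ℝ | a < |y|}.indicator (1 : ℝ → ℝ) y ≤ 1 := fun y =>
    indicator_le_self' (fun _ _ => zero_le_one) y
  have hj : ∀ j, ∫⁻ y, G j y ∂ν j ≤ ENNReal.ofReal (Real.exp (2 * (ν j {y | a < |y|}).toReal)) *
      (if j = k then ENNReal.ofReal (Real.exp 1) * ∫⁻ y, F y ∂ν k else 1) := by
    intro j
    by_cases hjk : j = k
    · subst hjk
      simp only [G, if_true]
      calc _ ≤ ∫⁻ y, ENNReal.ofReal (Real.exp 1) * F y ∂ν j := by
            refine lintegral_mono fun y => ?_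
            gcongr
            exact hone y
        _ = ENNReal.ofReal (Real.exp 1) * ∫⁻ y, F y ∂ν j :=
            lintegral_const_mul' _ _ ENNReal.ofReal_ne_top
        _ ≤ _ := by
            refine le_mul_of_one_le_left' ?_
            rw [← ENNReal.ofReal_one]
            exact ENNReal.ofReal_le_ofReal (Real.one_le_exp (by positivity))
    · simpa [G, hjk] using lintegral_exp_indicator_le j a
  refine (Finset.prod_le_prod' fun j _ => hj j).trans ?_
  rw [Finset.prod_mul_distrib, Finset.prod_ite_eq' Finset.univ k, if_pos (Finset.mem_univ k),
    ← ENNReal.ofReal_prod_of_nonneg fun _ _ => (Real.exp_pos _).le, ← Real.exp_sum, ← mul_assoc,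
    ← ENNReal.ofReal_mul (Real.exp_pos _).le, ← Real.exp_add, ← Finset.mul_sum]
  refine mul_le_mul_left (ENNReal.ofReal_le_ofReal (Real.exp_le_exp.2 ?_)) _
  have : ∑ j, (ν j {y | a < |y|}).toReal ≤ 1 := by
    rw [← ENNReal.toReal_sum fun _ _ => measure_ne_top _ _, ← Measure.finsetSum_apply]
    simpa using ENNReal.toReal_mono ENNReal.one_ne_top ha
  linarith

lemma lintegral_map_sum_large_le {Φ : ℝ → ℝ} (h : IsOrlicz Φ) {A : ℝ} (hA0 : 0 ≤ A)
    (hA : ∀ t : ℝ, 0 ≤ t → ∀ s, Φ (t * s) ≤ A * Real.exp t * Φ s) {a : ℝ}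
    (ha : (∑ k, ν k) {y | a < |y|} ≤ 1) :
    ∫⁻ x, ENNReal.ofReal (Φ (∑ k, large a (x k))) ∂Measure.pi ν ≤
      ENNReal.ofReal (A * Real.exp 3) *
        ∫⁻ y, ENNReal.ofReal (Φ (large a y)) ∂(∑ k, ν k) := by
  have hΦ := h.measurable
  have hm : MeasurableSet {y : ℝ | a < |y|} := measurableSet_lt measurable_const measurable_id.abs
  have hind : Measurable ({y : ℝ | a < |y|}.indicator (1 : ℝ → ℝ)) := measurable_one.indicator hm
  calc _ ≤ ∫⁻ x, ENNReal.ofReal A * ∑ k,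
        ENNReal.ofReal (Real.exp (∑ j, {y : ℝ | a < |y|}.indicator 1 (x j))) *
          ENNReal.ofReal (Φ (large a (x k))) ∂Measure.pi ν := by
        refine lintegral_mono fun x => ?_
        rw [← Finset.mul_sum, ← ENNReal.ofReal_sum_of_nonneg fun _ _ => h.nonneg _,
          ← ENNReal.ofReal_mul (Real.exp_pos _).le, ← ENNReal.ofReal_mul hA0, ← mul_assoc]
        exact ENNReal.ofReal_le_ofReal (map_sum_large_le h hA0 hA a x)
    _ = ENNReal.ofReal A * ∑ k, ∫⁻ x,
        ENNReal.ofReal (Real.exp (∑ j, {y : ℝ | a < |y|}.indicator 1 (x j))) *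
          ENNReal.ofReal (Φ (large a (x k))) ∂Measure.pi ν := by
        rw [lintegral_const_mul' _ _ ENNReal.ofReal_ne_top, lintegral_finsetSum]
        intro k _
        fun_prop
    _ ≤ ENNReal.ofReal A * ∑ k, ENNReal.ofReal (Real.exp 3) *
          ∫⁻ y, ENNReal.ofReal (Φ (large a y)) ∂ν k := by
        gcongr with k
        exact lintegral_exp_count_mul_le ha k (F := fun y => ENNReal.ofReal (Φ (large a y)))
          (by fun_prop)
    _ = _ := by
        rw [← Finset.mul_sum, lintegral_finsetSum_measure, ENNReal.ofReal_mul hA0, mul_assoc]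

lemma lintegral_map_sum_le {Φ : ℝ → ℝ} (h : IsOrlicz Φ) {A : ℝ} (hA0 : 0 ≤ A)
    (hA : ∀ t : ℝ, 0 ≤ t → ∀ s, Φ (t * s) ≤ A * Real.exp t * Φ s) {a r : ℝ} (ha0 : 0 ≤ a)
    (har : a ≤ r) (ha : (∑ k, ν k) {y | a < |y|} ≤ 1)
    (hexp : 0 < a → ∫⁻ x, ENNReal.ofReal (Real.exp |∑ k, r⁻¹ * small a (x k)|) ∂Measure.pi ν ≤
      ENNReal.ofReal (Real.exp 3)) :
    ∫⁻ x, ENNReal.ofReal (Φ (∑ k, x k)) ∂Measure.pi ν ≤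
      ENNReal.ofReal (A * Real.exp 2 * (A * Real.exp 3)) *
        (∫⁻ y, ENNReal.ofReal (Φ (large a y)) ∂(∑ k, ν k) + ENNReal.ofReal (Φ r)) := by
  have hΦ := h.measurable
  have hsmall : ∫⁻ x, ENNReal.ofReal (Φ (∑ k, small a (x k))) ∂Measure.pi ν ≤
      ENNReal.ofReal (A * Real.exp 3) * ENNReal.ofReal (Φ r) := by
    rcases ha0.eq_or_lt with rfl | hpos
    -- At level `0` the small part vanishes, so no positive radius is needed.
    · have : ∀ y : ℝ, small 0 y = 0 := fun y => abs_nonpos_iff.1 (abs_small_le le_rfl y)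
      simp [this, h.map_zero]
    · exact lintegral_map_sum_le_of_exp h hA0 hA (hpos.trans_le har)
        (hexp hpos)
  calc _ ≤ ∫⁻ x, ENNReal.ofReal (A * Real.exp 2) *
        (ENNReal.ofReal (Φ (∑ k, small a (x k))) + ENNReal.ofReal (Φ (∑ k, large a (x k))))
          ∂Measure.pi ν := by
        refine lintegral_mono fun x => ?_
        rw [← ENNReal.ofReal_add (h.nonneg _) (h.nonneg _), ← ENNReal.ofReal_mul (by positivity)]
        refine ENNReal.ofReal_le_ofReal ?_
        have := h.map_add_le hA (∑ k, small a (x k)) (∑ k, large a (x k))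
        simpa only [← Finset.sum_add_distrib, small_add_large] using this
    _ ≤ ENNReal.ofReal (A * Real.exp 2) * (ENNReal.ofReal (A * Real.exp 3) *
        ENNReal.ofReal (Φ r) + ENNReal.ofReal (A * Real.exp 3) *
          ∫⁻ y, ENNReal.ofReal (Φ (large a y)) ∂(∑ k, ν k)) := by
        rw [lintegral_const_mul' _ _ ENNReal.ofReal_ne_top, lintegral_add_left (by fun_prop)]
        gcongr
        exact lintegral_map_sum_large_le h hA0 hA ha
    _ = _ := by
        rw [ENNReal.ofReal_mul (p := A * Real.exp 2) (by positivity)]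
        ring

/-- After division by `r = a + m` the small parts are bounded by `1`, so `exp w ≤ 1 + 2 * |w|`. The
means of the `2 * |w|` add up to at most `2 * m / r ≤ 2`; the two signs cost a factor `2 ≤ exp 1`.
-/
lemma lintegral_exp_small_le_of_integrable (hint : ∀ k, Integrable (fun y => y) (ν k))
    {a : ℝ} (ha : 0 < a) :
    ∫⁻ x, ENNReal.ofReal (Real.exp |∑ k, (a + ∑ j, ∫ y, |y| ∂ν j)⁻¹ * small a (x k)|)
      ∂Measure.pi ν ≤ ENNReal.ofReal (Real.exp 3) := by
  set m := ∑ j, ∫ y, |y| ∂ν j with hm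
  have hm0 : 0 ≤ m := Finset.sum_nonneg fun j _ => integral_nonneg fun _ => abs_nonneg _
  have hr : 0 < a + m := by positivity
  have hθ : 0 < (a + m)⁻¹ := inv_pos.2 hr
  have hsm : ∀ y, |(a + m)⁻¹ * small a y| ≤ 1 := by
    intro y
    rw [abs_mul, abs_of_pos hθ, inv_mul_le_one₀ hr]
    exact (abs_small_le ha.le y).trans (by linarith)
  have hle : ∀ c : ℝ, |c| ≤ 1 → ∀ k,
      ∫⁻ y, ENNReal.ofReal (Real.exp (c * ((a + m)⁻¹ * small a y))) ∂ν k ≤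
      ENNReal.ofReal (1 + 2 * ((a + m)⁻¹ * ∫ y, |y| ∂ν k)) := by
    intro c hc k
    have hi : Integrable (fun y => 1 + 2 * ((a + m)⁻¹ * |y|)) (ν k) :=
      (integrable_const _).add (((hint k).abs.const_mul _).const_mul _)
    have e : ∫ y, (1 + 2 * ((a + m)⁻¹ * |y|)) ∂ν k = 1 + 2 * ((a + m)⁻¹ * ∫ y, |y| ∂ν k) := by
      rw [integral_add (integrable_const _) (((hint k).abs.const_mul _).const_mul _),
        integral_const_mul, integral_const_mul]
      simp
    rw [← e, ofReal_integral_eq_lintegral_ofReal hi (.of_forall fun y => by positivity)]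
    refine lintegral_mono fun y => ENNReal.ofReal_le_ofReal ?_
    set w := (a + m)⁻¹ * small a y with hw
    have h1 := hsm y
    have h3 : |w| ≤ (a + m)⁻¹ * |y| := by
      rw [hw, abs_mul, abs_of_pos hθ]
      exact mul_le_mul_of_nonneg_left (abs_small_le_abs a y) hθ.le
    have h4 : |c * w| ≤ |w| := by
      rw [abs_mul]; exact mul_le_of_le_one_left (abs_nonneg _) hc
    have h2 := exp_le_one_add_add_sq (h4.trans h1)
    have h5 : (c * w) ^ 2 ≤ |w| := by
      rw [← sq_abs]; nlinarith [abs_nonneg w, abs_nonneg (c * w)]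
    have h6 := le_abs_self (c * w)
    linarith
  refine (lintegral_exp_abs_sum_le (φ := fun y => (a + m)⁻¹ * small a y) (by fun_prop)
    (fun k => by simpa using hle 1 (by simp) k)
    (fun k => by simpa using hle (-1) (by simp) k)).trans (ENNReal.ofReal_le_ofReal ?_)
  rw [← Finset.mul_sum, ← Finset.mul_sum, ← hm]
  have h1 : (a + m)⁻¹ * m ≤ 1 := by
    rw [inv_mul_le_one₀ hr]; linarith
  calc 2 * Real.exp (2 * ((a + m)⁻¹ * m)) ≤ Real.exp 1 * Real.exp 2 := by
        gcongr
        · linarith [Real.exp_one_gt_d9]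
        · linarith
    _ = Real.exp 3 := by rw [← Real.exp_add]; norm_num

lemma integrable_small_sq (a : ℝ) (ha : 0 ≤ a) (k : Fin n) :
    Integrable (fun y => small a y ^ 2) (ν k) := by
  refine .of_bound (by fun_prop) (a ^ 2) (.of_forall fun y => ?_)
  rw [Real.norm_eq_abs, abs_pow]
  exact pow_le_pow_left₀ (abs_nonneg _) (abs_small_le ha y) 2

lemma integrable_small (a : ℝ) (ha : 0 ≤ a) (k : Fin n) : Integrable (small a) (ν k) :=
  .of_bound (by fun_prop) a (.of_forall fun y => abs_small_le ha y)

/-- Symmetry kills the linear term of `exp w ≤ 1 + w + w ^ 2`, so only the variance `v` remains, and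
`v / r ^ 2 ≤ 1`. -/
lemma lintegral_exp_small_le_of_symm (hs : ∀ k, (ν k).map (fun y => -y) = ν k) {a : ℝ}
    (ha : 0 < a) :
    ∫⁻ x, ENNReal.ofReal (Real.exp
      |∑ k, (a + √(∑ j, ∫ y, small a y ^ 2 ∂ν j))⁻¹ * small a (x k)|)
      ∂Measure.pi ν ≤ ENNReal.ofReal (Real.exp 3) := by
  set v := ∑ j, ∫ y, small a y ^ 2 ∂ν j with hv
  have hv0 : 0 ≤ v := Finset.sum_nonneg fun j _ => integral_nonneg fun _ => sq_nonneg _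
  have hr : 0 < a + √v := by positivity
  set θ := (a + √v)⁻¹
  have hθ : 0 < θ := inv_pos.2 hr
  have hsm : ∀ y, |θ * small a y| ≤ 1 := by
    intro y
    rw [abs_mul, abs_of_pos hθ, inv_mul_le_one₀ hr]
    exact (abs_small_le ha.le y).trans (by linarith [Real.sqrt_nonneg v])
  have hle : ∀ c : ℝ, |c| = 1 → ∀ k, ∫⁻ y, ENNReal.ofReal (Real.exp (c * (θ * small a y))) ∂ν k ≤
      ENNReal.ofReal (1 + θ ^ 2 * ∫ y, small a y ^ 2 ∂ν k) := by
    intro c hc k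
    have hi1 : Integrable (fun y => 1 + (c * θ) * small a y) (ν k) :=
      (integrable_const _).add ((integrable_small a ha.le k).const_mul _)
    have hi2 : Integrable (fun y => θ ^ 2 * small a y ^ 2) (ν k) :=
      (integrable_small_sq a ha.le k).const_mul _
    have e : ∫ y, (1 + (c * θ) * small a y + θ ^ 2 * small a y ^ 2) ∂ν k =
        1 + θ ^ 2 * ∫ y, small a y ^ 2 ∂ν k := by
      rw [integral_add hi1 hi2, integral_add (integrable_const _)
        ((integrable_small a ha.le k).const_mul _), integral_const_mul, integral_const_mul,
        integral_small_eq_zero (hs k)]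
      simp
    have hpt : ∀ y, Real.exp (c * (θ * small a y)) ≤
        1 + (c * θ) * small a y + θ ^ 2 * small a y ^ 2 := by
      intro y
      have h2 := exp_le_one_add_add_sq (x := c * (θ * small a y))
        (by rw [abs_mul, hc, one_mul]; exact hsm y)
      have hc2 : c ^ 2 = 1 := by rw [← sq_abs, hc, one_pow]
      rw [mul_pow, mul_pow, hc2] at h2
      linarith
    rw [← e, ofReal_integral_eq_lintegral_ofReal
      (f := fun y => 1 + (c * θ) * small a y + θ ^ 2 * small a y ^ 2) (hi1.add hi2)
      (.of_forall fun y => (Real.exp_pos _).le.trans (hpt y))]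
    exact lintegral_mono fun y => ENNReal.ofReal_le_ofReal (hpt y)
  refine (lintegral_exp_abs_sum_le (φ := fun y => θ * small a y) (by fun_prop)
    (fun k => by simpa using hle 1 (by simp) k)
    (fun k => by simpa using hle (-1) (by simp) k)).trans (ENNReal.ofReal_le_ofReal ?_)
  rw [← Finset.mul_sum, ← hv]
  have h1 : θ ^ 2 * v ≤ 1 := by
    have h2 : θ * √v ≤ 1 := by rw [inv_mul_le_one₀ hr]; linarith
    calc θ ^ 2 * v = (θ * √v) ^ 2 := by rw [mul_pow, Real.sq_sqrt hv0]
      _ ≤ 1 := pow_le_one₀ (by positivity) h2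
  calc 2 * Real.exp (θ ^ 2 * v) ≤ Real.exp 1 * Real.exp 2 := by
        gcongr
        · linarith [Real.exp_one_gt_d9]
        · linarith
    _ = Real.exp 3 := by rw [← Real.exp_add]; norm_num

/-! ### Lower estimates: symmetries and the maximum. -/

lemma measurePreserving_small_sub_large {P : Measure ℝ} (hs : P.map (fun y => -y) = P) (a : ℝ) :
    MeasurePreserving (fun y => small a y - large a y) P P := by
  refine ⟨by fun_prop, ?_⟩
  ext s hm
  have ht : MeasurableSet {y : ℝ | |y| ≤ a} := measurableSet_le measurable_id.abs measurable_const
  have hpos : (fun y => small a y - large a y) ⁻¹' s ∩ {y | |y| ≤ a} = s ∩ {y | |y| ≤ a} := by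
    ext y
    simp only [mem_inter_iff, mem_preimage, mem_ofPred_eq, and_congr_left_iff]
    intro h
    simp [small, large, h, h.not_gt]
  have hneg : (fun y => small a y - large a y) ⁻¹' s \ {y | |y| ≤ a} =
      (fun y => -y) ⁻¹' (s \ {y | |y| ≤ a}) := by
    ext y
    simp only [mem_sdiff, mem_preimage, mem_ofPred_eq, abs_neg, and_congr_left_iff]
    intro h
    simp [small, large, h, not_le.1 h]
  rw [Measure.map_apply (by fun_prop) hm, ← measure_inter_add_sdiff _ ht, hpos, hneg,
    ← Measure.map_apply (by fun_prop) (hm.diff ht), hs, measure_inter_add_sdiff _ ht]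

lemma measurePreserving_units_mul {P : Measure ℝ} (hs : P.map (fun y => -y) = P) (ε : ℤˣ) :
    MeasurePreserving (fun y => ((ε : ℤ) : ℝ) * y) P P := by
  rcases Int.units_eq_one_or ε with rfl | rfl
  · have e : (fun y : ℝ => (((1 : ℤˣ) : ℤ) : ℝ) * y) = id := by ext; simp
    rw [e]
    exact .id P
  · simpa using (⟨by fun_prop, hs⟩ : MeasurePreserving (fun y => -y) P P)

/-- Let `i` be a coordinate of maximal modulus. Flipping all other signs and averaging the two
signed sums leaves `± x i`; convexity and summation over all signs finish. -/
lemma IsOrlicz.card_mul_map_norm_le {Φ : ℝ → ℝ} (h : IsOrlicz Φ) {n : ℕ} (x : Fin n → ℝ) :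
    Fintype.card (Fin n → ℤˣ) * Φ ‖x‖ ≤
      ∑ ε : Fin n → ℤˣ, Φ (∑ k, ((ε k : ℤ) : ℝ) * x k) := by
  rcases Nat.eq_zero_or_pos n with rfl | hn
  · rw [Subsingleton.elim x 0, norm_zero, h.map_zero]; simp [h.map_zero]
  · have : NeZero n := ⟨hn.ne'⟩
    obtain ⟨i, hi⟩ := exists_abs_eq_norm x
    rw [← hi, h.map_abs]
    let τ : Fin n → ℤˣ := Function.update (fun _ => -1) i 1
    have hτ : ∑ ε : Fin n → ℤˣ, Φ (∑ k, (((τ * ε) k : ℤ) : ℝ) * x k) =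
        ∑ ε : Fin n → ℤˣ, Φ (∑ k, ((ε k : ℤ) : ℝ) * x k) :=
      Fintype.sum_equiv (Equiv.mulLeft τ) _ _ fun _ => rfl
    have hpt : ∀ ε : Fin n → ℤˣ, 2 * Φ (x i) ≤
        Φ (∑ k, ((ε k : ℤ) : ℝ) * x k) + Φ (∑ k, (((τ * ε) k : ℤ) : ℝ) * x k) := by
      intro ε
      have e : Φ (x i) = Φ (((ε i : ℤ) : ℝ) * x i) := by
        rcases Int.units_eq_one_or (ε i) with h' | h' <;> simp [h', h.even]
      rw [e]
      apply h.map_half_add_le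
      rw [← Finset.sum_add_distrib, Finset.sum_eq_single i]
      · simp [τ]; ring
      · intro k _ hk
        simp [τ, Function.update_of_ne hk]
      · simp
    have := Finset.sum_le_sum fun ε (_ : ε ∈ Finset.univ) => hpt ε
    rw [Finset.sum_add_distrib, hτ] at this
    simp only [Finset.sum_const, Finset.card_univ, nsmul_eq_mul] at this
    linarith

variable {n : ℕ} {ν : Fin n → Measure ℝ} [∀ k, IsProbabilityMeasure (ν k)]

/-- By independence, no coordinate exceeds `u` with probability `∏ (1 - p k) ≤ exp (-s) ≤ 1 / (1 +
s)`, where `s = ∑ p k`. Then `min s 1 ≤ 2 * s / (1 + s)`. -/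
lemma min_tail_le {u : ℝ} (hu : 0 ≤ u) :
    min ((∑ k, ν k) {y | u < |y|}) 1 ≤ 2 * Measure.pi ν {x | u < ‖x‖} := by
  have hm : MeasurableSet {y : ℝ | u < |y|} := measurableSet_lt measurable_const measurable_id.abs
  have hm' : MeasurableSet {x : Fin n → ℝ | u < ‖x‖} :=
    measurableSet_lt measurable_const measurable_norm
  set p : Fin n → ℝ := fun k => (ν k).real {y | u < |y|} with hp
  have hcompl : (Measure.pi ν).real {x | u < ‖x‖}ᶜ = ∏ k, (1 - p k) := by
    have e : {x : Fin n → ℝ | u < ‖x‖}ᶜ = univ.pi fun _ => {y : ℝ | u < |y|}ᶜ := by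
      ext x
      simp [pi_norm_le_iff_of_nonneg hu]
    rw [e, measureReal_def, Measure.pi_pi, ENNReal.toReal_prod]
    exact Finset.prod_congr rfl fun k _ => probReal_compl_eq_one_sub hm
  rw [probReal_compl_eq_one_sub hm'] at hcompl
  set s := ∑ k, p k with hs
  have hs0 : 0 ≤ s := Finset.sum_nonneg fun k _ => measureReal_nonneg
  have hprod : ∏ k, (1 - p k) ≤ (1 + s)⁻¹ := by
    calc ∏ k, (1 - p k) ≤ ∏ k, Real.exp (-p k) :=
          Finset.prod_le_prod (fun k _ => sub_nonneg.2 measureReal_le_one)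
            fun k _ => by linarith [Real.add_one_le_exp (-p k)]
      _ = (Real.exp s)⁻¹ := by rw [← Real.exp_sum, Finset.sum_neg_distrib, Real.exp_neg]
      _ ≤ (1 + s)⁻¹ := by
          gcongr
          linarith [Real.add_one_le_exp s]
  have hreal : min s 1 ≤ 2 * (Measure.pi ν).real {x | u < ‖x‖} := by
    have h1 : 1 - (1 + s)⁻¹ ≤ (Measure.pi ν).real {x | u < ‖x‖} := by linarith
    have h2 : min s 1 ≤ 2 * (1 - (1 + s)⁻¹) := by
      have e : 2 * (1 - (1 + s)⁻¹) = 2 * s / (1 + s) := by field_simp; ring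
      rw [e, le_div_iff₀ (by positivity)]
      rcases le_total s 1 with h | h
      · rw [min_eq_left h]; nlinarith
      · rw [min_eq_right h]; linarith
    linarith
  have hΛ : (∑ k, ν k) {y | u < |y|} = ENNReal.ofReal s := by
    rw [Measure.finsetSum_apply, hs, ENNReal.ofReal_sum_of_nonneg fun _ _ => measureReal_nonneg]
    simp
  rw [hΛ, ← ENNReal.ofReal_one, ← ENNReal.ofReal_min]
  refine (ENNReal.ofReal_le_ofReal hreal).trans ?_
  rw [ENNReal.ofReal_mul zero_le_two, ofReal_measureReal]
  simp

lemma phiMoment_rearrangement_le {Φ : ℝ → ℝ} (h : IsOrlicz Φ) {g : ℝ → ℝ}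
    (hd : ∀ u : ℝ, 0 ≤ u → halfLineMeasure {s | u < |g s|} = (∑ k, ν k) {x | u < |x|}) :
    phiMoment Φ (rearrangement g) ≤ 2 * ∫⁻ x, ENNReal.ofReal (Φ ‖x‖) ∂Measure.pi ν := by
  refine h.lintegral_le_of_tail_le (C := 2) (aemeasurable_rearrangement hd)
    measurable_norm.aemeasurable (rearrangement_nonneg g) (fun _ => norm_nonneg _) fun u hu => ?_
  rw [unitMeasure_lt_rearrangement hd hu]
  exact min_tail_le hu

lemma lintegral_map_norm_le {Φ : ℝ → ℝ} (h : IsOrlicz Φ)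
    (hs : ∀ k, (ν k).map (fun y => -y) = ν k) :
    ∫⁻ x, ENNReal.ofReal (Φ ‖x‖) ∂Measure.pi ν ≤
      ∫⁻ x, ENNReal.ofReal (Φ (∑ k, x k)) ∂Measure.pi ν := by
  have hΦ := h.measurable
  set N := Fintype.card (Fin n → ℤˣ)
  have hsign : ∀ ε : Fin n → ℤˣ,
      ∫⁻ x, ENNReal.ofReal (Φ (∑ k, ((ε k : ℤ) : ℝ) * x k)) ∂Measure.pi ν =
        ∫⁻ x, ENNReal.ofReal (Φ (∑ k, x k)) ∂Measure.pi ν := fun ε =>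
    (measurePreserving_pi ν ν fun k => measurePreserving_units_mul (hs k) (ε k)).lintegral_comp
      (f := fun x => ENNReal.ofReal (Φ (∑ k, x k))) (by fun_prop)
  have : (N : ℝ≥0∞) * ∫⁻ x, ENNReal.ofReal (Φ ‖x‖) ∂Measure.pi ν ≤
      N * ∫⁻ x, ENNReal.ofReal (Φ (∑ k, x k)) ∂Measure.pi ν := by
    calc _ = ∫⁻ x, ENNReal.ofReal (N * Φ ‖x‖) ∂Measure.pi ν := by
          rw [← lintegral_const_mul' _ _ (ENNReal.natCast_ne_top N)]
          simp_rw [ENNReal.ofReal_mul (Nat.cast_nonneg N), ENNReal.ofReal_natCast]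
      _ ≤ ∫⁻ x, ∑ ε : Fin n → ℤˣ, ENNReal.ofReal (Φ (∑ k, ((ε k : ℤ) : ℝ) * x k))
            ∂Measure.pi ν := by
          refine lintegral_mono fun x => ?_
          rw [← ENNReal.ofReal_sum_of_nonneg fun _ _ => h.nonneg _]
          exact ENNReal.ofReal_le_ofReal (h.card_mul_map_norm_le x)
      _ = _ := by
          rw [lintegral_finsetSum _ fun _ _ => by fun_prop]
          simp [hsign, N]
  exact (ENNReal.mul_le_mul_iff_right (by simp [N])
    (ENNReal.natCast_ne_top N)).1 this

/-- The small part is the average of `small + large` and `small - large`, which have the same law;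
convexity does the rest. -/
lemma lintegral_map_sum_small_le {Φ : ℝ → ℝ} (h : IsOrlicz Φ)
    (hs : ∀ k, (ν k).map (fun y => -y) = ν k) (a : ℝ) :
    ∫⁻ x, ENNReal.ofReal (Φ (∑ k, small a (x k))) ∂Measure.pi ν ≤
      ∫⁻ x, ENNReal.ofReal (Φ (∑ k, x k)) ∂Measure.pi ν := by
  have hΦ := h.measurable
  have hflip : ∫⁻ x, ENNReal.ofReal (Φ (∑ k, (small a (x k) - large a (x k)))) ∂Measure.pi ν =
      ∫⁻ x, ENNReal.ofReal (Φ (∑ k, x k)) ∂Measure.pi ν :=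
    (measurePreserving_pi ν ν fun k => measurePreserving_small_sub_large (hs k) a).lintegral_comp
      (f := fun x => ENNReal.ofReal (Φ (∑ k, x k))) (by fun_prop)
  refine (ENNReal.mul_le_mul_iff_right two_ne_zero ENNReal.ofNat_ne_top).1 ?_
  calc _ = ∫⁻ x, ENNReal.ofReal (2 * Φ (∑ k, small a (x k))) ∂Measure.pi ν := by
        rw [← lintegral_const_mul' _ _ ENNReal.ofNat_ne_top]
        simp_rw [ENNReal.ofReal_mul zero_le_two, ENNReal.ofReal_ofNat]
    _ ≤ ∫⁻ x, (ENNReal.ofReal (Φ (∑ k, x k)) +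
          ENNReal.ofReal (Φ (∑ k, (small a (x k) - large a (x k))))) ∂Measure.pi ν := by
        refine lintegral_mono fun x => ?_
        rw [← ENNReal.ofReal_add (h.nonneg _) (h.nonneg _)]
        refine ENNReal.ofReal_le_ofReal (h.map_half_add_le ?_)
        rw [← Finset.sum_add_distrib, Finset.mul_sum]
        refine Finset.sum_congr rfl fun k _ => ?_
        linarith [small_add_large a (x k)]
    _ = _ := by rw [lintegral_add_left (by fun_prop), hflip, two_mul]

/-! ### From the second moment of the small part to its first moment. -/

lemma integral_sum_small_sq (hs : ∀ k, (ν k).map (fun y => -y) = ν k) {a : ℝ} (ha : 0 ≤ a) :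
    ∫ x, (∑ k, small a (x k)) ^ 2 ∂Measure.pi ν = ∑ k, ∫ y, small a y ^ 2 ∂ν k := by
  have hL : ∀ k, MemLp (small a) 2 (ν k) := fun k =>
    .of_bound (by fun_prop) a (.of_forall fun y => abs_small_le ha y)
  have hz : ∀ k, ∫ x, small a (x k) ∂Measure.pi ν = 0 := fun k => by
    have := (measurePreserving_eval ν k).map_eq
    rw [← integral_small_eq_zero (hs k) a, ← this,
      integral_map (measurable_pi_apply k).aemeasurable (by fun_prop)]
  have hv := variance_sum_pi (μ := ν) (X := fun _ => small a) hL
  rw [variance_of_integral_eq_zero (by fun_prop)] at hv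
  · simp only [Finset.sum_apply] at hv
    rw [hv]
    refine Finset.sum_congr rfl fun k _ => ?_
    rw [variance_of_integral_eq_zero (by fun_prop) (integral_small_eq_zero (hs k) a)]
  · simp only [Finset.sum_apply]
    rw [integral_finsetSum]
    · exact Finset.sum_eq_zero fun k _ => hz k
    · exact fun k _ => .of_bound
        ((measurable_small a).comp (measurable_pi_apply k)).aestronglyMeasurable a
        (.of_forall fun x => abs_small_le ha (x k))

lemma sq_le_mul_add_exp {L y : ℝ} (hL : 0 < L) (hy : 0 ≤ y) :
    y ^ 2 ≤ L * y + 6 / L * Real.exp y := by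
  have h3 : y ^ 3 ≤ 6 * Real.exp y := by
    have := Real.pow_div_factorial_le_exp y hy 3
    rw [div_le_iff₀ (by positivity)] at this
    simpa [Nat.factorial, mul_comm] using this
  have h1 : y ^ 2 ≤ L * y + y ^ 3 / L := by
    rcases le_total y L with h | h
    · have : 0 ≤ y ^ 3 / L := by positivity
      nlinarith
    · have : y ^ 2 ≤ y ^ 3 / L := by
        rw [le_div_iff₀ hL]; nlinarith [sq_nonneg y]
      nlinarith [mul_nonneg hL.le hy]
  have h2 : y ^ 3 / L ≤ 6 / L * Real.exp y := by
    rw [div_mul_eq_mul_div]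
    gcongr
  linarith

/-- A reverse Hölder inequality: the second moment of the sum `H` lies between its first moment and
the bounded exponential moment of `|H| / r`. By `sq_le_mul_add_exp` the exponential term takes an
arbitrarily small share. -/
lemma sqrt_sum_small_sq_le (hs : ∀ k, (ν k).map (fun y => -y) = ν k) {a : ℝ} (ha : 0 ≤ a) :
    √(∑ k, ∫ y, small a y ^ 2 ∂ν k) ≤
      a + 384 * Real.exp 3 * ∫ x, |∑ k, small a (x k)| ∂Measure.pi ν := by
  set v := ∑ k, ∫ y, small a y ^ 2 ∂ν k with hv
  set H : (Fin n → ℝ) → ℝ := fun x => ∑ k, small a (x k)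
  have hE0 : 0 ≤ ∫ x, |H x| ∂Measure.pi ν := integral_nonneg fun _ => abs_nonneg _
  have he : 0 < Real.exp 3 := Real.exp_pos 3
  rcases le_or_gt (√v) a with hle | hlt
  · have : 0 ≤ 384 * Real.exp 3 * ∫ x, |H x| ∂Measure.pi ν := by positivity
    linarith
  rcases ha.eq_or_lt with rfl | hpos
  · have : ∀ y : ℝ, small 0 y = 0 := fun y => abs_nonpos_iff.1 (abs_small_le le_rfl y)
    simp [hv, this] at hlt
  have hexp := lintegral_exp_small_le_of_symm hs hpos
  rw [← hv] at hexp
  set r := a + √v with hr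
  have hr0 : 0 < r := by positivity
  have hv0 : 0 ≤ v := Finset.sum_nonneg fun j _ => integral_nonneg fun _ => sq_nonneg _
  simp only [← Finset.mul_sum] at hexp
  have hbd : ∀ x, |H x| ≤ n * a := fun x =>
    (Finset.abs_sum_le_sum_abs _ _).trans
      ((Finset.sum_le_card_nsmul _ _ a fun k _ => abs_small_le ha (x k)).trans (by simp))
  have hHm : Measurable H := by fun_prop
  have hiH : Integrable (fun x => |H x|) (Measure.pi ν) :=
    .of_bound (by fun_prop) (n * a) (.of_forall fun x => by simpa using hbd x)
  have hie : Integrable (fun x => Real.exp |r⁻¹ * H x|) (Measure.pi ν) :=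
    ⟨by fun_prop, (hasFiniteIntegral_iff_ofReal (.of_forall fun _ => (Real.exp_pos _).le)).2
      (hexp.trans_lt ENNReal.ofReal_lt_top)⟩
  have hie' : ∫ x, Real.exp |r⁻¹ * H x| ∂Measure.pi ν ≤ Real.exp 3 := by
    rw [integral_eq_lintegral_of_nonneg_ae (.of_forall fun _ => (Real.exp_pos _).le)
      hie.aestronglyMeasurable]
    exact ENNReal.toReal_le_of_le_ofReal he.le hexp
  -- Chosen so that `6 / L * exp 3 = 1 / 8`, half of the lower bound `1 / 4` for `v / r ^ 2`, which
  -- holds because `a < √v` gives `r ≤ 2 * √v`. Then `384 = 8 * 48`.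
  set L := 48 * Real.exp 3 with hL
  have hmain : r⁻¹ ^ 2 * v ≤ L * (r⁻¹ * ∫ x, |H x| ∂Measure.pi ν) + 6 / L * Real.exp 3 := by
    rw [hv, ← integral_sum_small_sq hs ha, ← integral_const_mul]
    calc ∫ x, r⁻¹ ^ 2 * H x ^ 2 ∂Measure.pi ν
        ≤ ∫ x, (L * (r⁻¹ * |H x|) + 6 / L * Real.exp |r⁻¹ * H x|) ∂Measure.pi ν := by
          refine integral_mono_of_nonneg (.of_forall fun x => by positivity)
            (((hiH.const_mul _).const_mul _).add (hie.const_mul _)) (.of_forall fun x => ?_)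
          have := sq_le_mul_add_exp (L := L) (by positivity) (abs_nonneg (r⁻¹ * H x))
          rw [sq_abs, mul_pow] at this
          simp only [abs_mul, abs_of_pos (inv_pos.2 hr0)] at this ⊢
          exact this
      _ = L * (r⁻¹ * ∫ x, |H x| ∂Measure.pi ν) +
          6 / L * ∫ x, Real.exp |r⁻¹ * H x| ∂Measure.pi ν := by
          rw [integral_add ((hiH.const_mul _).const_mul _) (hie.const_mul _),
            integral_const_mul, integral_const_mul, integral_const_mul]
      _ ≤ _ := by gcongr
  have h1 : 1 / 4 ≤ r⁻¹ ^ 2 * v := by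
    have h2 : r ≤ 2 * √v := by linarith
    rw [inv_pow, ← div_eq_inv_mul, le_div_iff₀ (by positivity)]
    nlinarith [Real.sq_sqrt hv0, Real.sqrt_nonneg v]
  have h2 : 6 / L * Real.exp 3 = 1 / 8 := by
    rw [hL]; field_simp; norm_num
  have h3 : 1 / 8 ≤ L * (r⁻¹ * ∫ x, |H x| ∂Measure.pi ν) := by linarith
  have h4 : r / 8 ≤ L * ∫ x, |H x| ∂Measure.pi ν := by
    have := mul_le_mul_of_nonneg_left h3 hr0.le
    calc r / 8 = r * (1 / 8) := by ring
      _ ≤ _ := this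
      _ = _ := by field_simp
  rw [hL] at h4
  linarith

/-! ### The norm of `L₁ + L₂` and truncation. -/

section SumNorm

variable {n : ℕ} {f : Fin n → ℝ → ℝ}

lemma eLpNorm_one_disjointSum (hf : ∀ k, AEMeasurable (f k) unitMeasure)
    {φ : ℝ → ℝ} (hφ : Measurable φ) (h0 : φ 0 = 0) :
    eLpNorm (fun t => φ (disjointSum f t)) 1 halfLineMeasure =
      ∫⁻ x, ENNReal.ofReal |φ x| ∂(∑ k, unitMeasure.map (f k)) := by
  rw [eLpNorm_one_eq_lintegral_enorm]
  simp_rw [Real.enorm_eq_ofReal_abs]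
  exact lintegral_disjointSum hf (F := fun x => ENNReal.ofReal |φ x|) (by fun_prop) (by simp [h0])

lemma eLpNorm_two_eq_rpow {ρ : Measure ℝ} (g : ℝ → ℝ) :
    eLpNorm g 2 ρ = (∫⁻ t, ENNReal.ofReal (g t ^ 2) ∂ρ) ^ (1 / 2 : ℝ) := by
  rw [eLpNorm_eq_lintegral_rpow_enorm_toReal two_ne_zero ENNReal.ofNat_ne_top]
  simp only [ENNReal.toReal_ofNat]
  congr 1
  refine lintegral_congr fun t => ?_
  rw [Real.enorm_eq_ofReal_abs, ENNReal.ofReal_rpow_of_nonneg (abs_nonneg _) zero_le_two]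
  norm_num

lemma eLpNorm_two_small_disjointSum (hf : ∀ k, AEMeasurable (f k) unitMeasure) {a : ℝ}
    (ha : 0 ≤ a) :
    eLpNorm (fun t => small a (disjointSum f t)) 2 halfLineMeasure =
      ENNReal.ofReal √(∑ k, ∫ y, small a y ^ 2 ∂unitMeasure.map (f k)) := by
  have hprob : ∀ k, IsProbabilityMeasure (unitMeasure.map (f k)) := fun k =>
    Measure.isProbabilityMeasure_map (hf k)
  rw [eLpNorm_two_eq_rpow, lintegral_disjointSum hf (F := fun x => ENNReal.ofReal (small a x ^ 2))
    (by fun_prop) (by simp [small]), lintegral_finsetSum_measure, Real.sqrt_eq_rpow,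
    ← ENNReal.ofReal_rpow_of_nonneg (Finset.sum_nonneg fun k _ => integral_nonneg
      fun _ => sq_nonneg _) (by norm_num),
    ENNReal.ofReal_sum_of_nonneg fun k _ => integral_nonneg fun _ => sq_nonneg _]
  congr 1
  refine Finset.sum_congr rfl fun k _ => ?_
  rw [ofReal_integral_eq_lintegral_ofReal
    (integrable_small_sq (ν := fun k => unitMeasure.map (f k)) a ha k)
    (.of_forall fun _ => sq_nonneg _)]

/-- From `min a |g| ^ 2 ≤ a * |g|`, the norm is at most the geometric mean of `a` and `‖g‖₁`. -/
lemma eLpNorm_two_min_le {ρ : Measure ℝ} {g : ℝ → ℝ} {a : ℝ} (ha : 0 ≤ a) :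
    eLpNorm (fun t => min a |g t|) 2 ρ ≤ ENNReal.ofReal a + eLpNorm g 1 ρ := by
  rw [eLpNorm_two_eq_rpow, eLpNorm_one_eq_lintegral_enorm]
  set N := ∫⁻ t, ‖g t‖ₑ ∂ρ
  have h1 : ∫⁻ t, ENNReal.ofReal (min a |g t| ^ 2) ∂ρ ≤ ENNReal.ofReal a * N := by
    rw [← lintegral_const_mul' _ _ ENNReal.ofReal_ne_top]
    refine lintegral_mono fun t => ?_
    rw [Real.enorm_eq_ofReal_abs, ← ENNReal.ofReal_mul ha, sq]
    exact ENNReal.ofReal_le_ofReal (mul_le_mul (min_le_left _ _) (min_le_right _ _)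
      (le_min ha (abs_nonneg _)) ha)
  have h2 : ENNReal.ofReal a * N ≤ (ENNReal.ofReal a + N) ^ (2 : ℝ) := by
    rw [ENNReal.rpow_two, sq]
    exact mul_le_mul' le_self_add le_add_self
  calc _ ≤ ((ENNReal.ofReal a + N) ^ (2 : ℝ)) ^ (1 / 2 : ℝ) :=
        ENNReal.rpow_le_rpow (h1.trans h2) (by norm_num)
    _ = _ := by rw [← ENNReal.rpow_mul]; norm_num

/-- For any decomposition, the small part is at most `min a |g₁| + |g₂|`, and the truncated `L₁`
piece lies in `L₂`. -/
lemma eLpNorm_small_le_add_sumNorm {ρ : Measure ℝ} (g : ℝ → ℝ) {a : ℝ} (ha : 0 ≤ a) :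
    eLpNorm (fun t => small a (g t)) 2 ρ ≤ ENNReal.ofReal a + sumNorm g ρ := by
  rw [← tsub_le_iff_left]
  refine le_iInf fun g₁ => le_iInf fun g₂ => le_iInf fun h₁ => le_iInf fun h₂ => le_iInf fun hg => ?_
  rw [tsub_le_iff_left]
  have hm1 : AEStronglyMeasurable (fun t => min a |g₁ t|) ρ :=
    (aemeasurable_const.min h₁.aestronglyMeasurable.aemeasurable.abs).aestronglyMeasurable
  have hm2 : AEStronglyMeasurable (fun t => |g₂ t|) ρ :=
    h₂.aestronglyMeasurable.aemeasurable.abs.aestronglyMeasurable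
  calc _ ≤ eLpNorm ((fun t => min a |g₁ t|) + fun t => |g₂ t|) 2 ρ := by
        refine eLpNorm_mono_ae_real ?_
        filter_upwards [hg] with t ht
        have e1 := abs_small_le ha (g t)
        have e2 := abs_small_le_abs a (g t)
        rw [ht, Pi.add_apply] at e2
        have e3 := abs_add_le (g₁ t) (g₂ t)
        rw [ht, Pi.add_apply] at e1
        simp only [ht, Pi.add_apply, Real.norm_eq_abs]
        rcases le_total a |g₁ t| with h | h
        · rw [min_eq_left h]; linarith [abs_nonneg (g₂ t)]
        · rw [min_eq_right h]; linarith
    _ ≤ eLpNorm (fun t => min a |g₁ t|) 2 ρ + eLpNorm (fun t => |g₂ t|) 2 ρ :=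
        eLpNorm_add_le hm1 hm2 one_le_two
    _ ≤ (ENNReal.ofReal a + eLpNorm g₁ 1 ρ) + eLpNorm g₂ 2 ρ := by
        gcongr
        · exact eLpNorm_two_min_le ha
        · exact (eLpNorm_norm g₂).le
    _ = _ := add_assoc _ _ _

lemma sumNorm_le_large_add_small {ρ : Measure ℝ} {g : ℝ → ℝ} (hg : AEMeasurable g ρ) (a : ℝ) :
    sumNorm g ρ ≤ eLpNorm (fun t => large a (g t)) 1 ρ + eLpNorm (fun t => small a (g t)) 2 ρ := by
  by_cases h1 : eLpNorm (fun t => large a (g t)) 1 ρ < ∞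
  · by_cases h2 : eLpNorm (fun t => small a (g t)) 2 ρ < ∞
    · refine iInf_le_of_le _ (iInf_le_of_le _ (iInf_le_of_le ⟨?_, h1⟩ (iInf_le_of_le ⟨?_, h2⟩
        (iInf_le_of_le ?_ le_rfl))))
      · exact ((measurable_large a).comp_aemeasurable hg).aestronglyMeasurable
      · exact ((measurable_small a).comp_aemeasurable hg).aestronglyMeasurable
      · exact .of_forall fun t => by
          simp only [Pi.add_apply]
          rw [add_comm, small_add_large]
    · simp [not_lt_top_iff.1 h2]
  · simp [not_lt_top_iff.1 h1]

end SumNorm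

/-! ### Transfer to the random variables and the two equivalences. -/

lemma MemOrlicz.integrable {Φ : ℝ → ℝ} (h : IsOrlicz Φ) (hne : ∃ x, 0 < Φ x) {g : ℝ → ℝ}
    {ρ : Measure ℝ} [IsFiniteMeasure ρ] (hg : MemOrlicz Φ g ρ) : Integrable g ρ := by
  obtain ⟨hm, hfin⟩ := hg
  obtain ⟨c, hc⟩ := iInf_lt_iff.1 hfin
  obtain ⟨hc0, hc⟩ := iInf_lt_iff.1 hc
  obtain ⟨hc1, -⟩ := iInf_lt_iff.1 hc
  have hi := (h.integrable_of_lintegral_lt_top hne (hm.div_const c)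
    (hc1.trans_lt ENNReal.one_lt_top)).mul_const c
  simpa [div_mul_cancel₀ _ hc0.ne'] using hi

lemma extend_ofReal (Φ : ℝ → ℝ) {x : ℝ} (hx : 0 ≤ x) :
    extend Φ (ENNReal.ofReal x) = ENNReal.ofReal (Φ x) := by
  simp [extend, ENNReal.toReal_ofReal hx]

section Moments

variable {Φ : ℝ → ℝ} {n : ℕ} {f : Fin n → ℝ → ℝ}

lemma phiMoment_sum_eq (h : IsOrlicz Φ) (hf : ∀ k, AEMeasurable (f k) unitMeasure)
    (hind : iIndepFun f unitMeasure) :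
    phiMoment Φ (fun s => ∑ k, f k s) =
      ∫⁻ x, ENNReal.ofReal (Φ (∑ k, x k)) ∂Measure.pi fun k => unitMeasure.map (f k) := by
  have hΦ := h.measurable
  rw [← hind.map_fun_eq_pi_map hf, lintegral_map' (by fun_prop) (aemeasurable_pi_lambda _ hf)]
  rfl

variable {ν : Fin n → Measure ℝ} [∀ k, IsProbabilityMeasure (ν k)]

lemma integrable_pi_eval (hint : ∀ k, Integrable (fun y => y) (ν k)) (k : Fin n) :
    Integrable (fun x => x k) (Measure.pi ν) :=
  (measurePreserving_eval ν k).integrable_comp_of_integrable (hint k)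

lemma integrable_sum_pi (hint : ∀ k, Integrable (fun y => y) (ν k)) :
    Integrable (fun x => ∑ k, x k) (Measure.pi ν) :=
  integrable_finsetSum _ fun k _ => integrable_pi_eval hint k

lemma map_sum_integral_abs_le_of_nonneg (h : IsOrlicz Φ)
    (hint : ∀ k, Integrable (fun y => y) (ν k))
    (hnn : ∀ k, ∀ᵐ y ∂ν k, 0 ≤ y) :
    ENNReal.ofReal (Φ (∑ k, ∫ y, |y| ∂ν k)) ≤
      ∫⁻ x, ENNReal.ofReal (Φ (∑ k, x k)) ∂Measure.pi ν := by
  have e : ∑ k, ∫ y, |y| ∂ν k = ∫ x, ∑ k, x k ∂Measure.pi ν := by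
    rw [integral_finsetSum _ fun k _ => integrable_pi_eval hint k]
    refine Finset.sum_congr rfl fun k _ => ?_
    have h1 : ∫ y, |y| ∂ν k = ∫ y, y ∂ν k :=
      integral_congr_ae ((hnn k).mono fun y hy => abs_of_nonneg hy)
    rw [h1]
    conv_lhs => rw [← (measurePreserving_eval ν k).map_eq]
    rw [integral_map (measurable_pi_apply k).aemeasurable (by fun_prop)]
  rw [e]
  exact h.jensen (integrable_sum_pi hint)

lemma lintegral_map_norm_le_of_nonneg (h : IsOrlicz Φ) (hnn : ∀ k, ∀ᵐ y ∂ν k, 0 ≤ y) :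
    ∫⁻ x, ENNReal.ofReal (Φ ‖x‖) ∂Measure.pi ν ≤
      ∫⁻ x, ENNReal.ofReal (Φ (∑ k, x k)) ∂Measure.pi ν := by
  have hae : ∀ᵐ x ∂Measure.pi ν, ∀ k, 0 ≤ x k :=
    ae_all_iff.2 fun k => (measurePreserving_eval ν k).quasiMeasurePreserving.ae (hnn k)
  refine lintegral_mono_ae (hae.mono fun x hx => ENNReal.ofReal_le_ofReal (h.mono ?_))
  have hsum : 0 ≤ ∑ k, x k := Finset.sum_nonneg fun k _ => hx k
  rw [abs_norm, abs_of_nonneg hsum, pi_norm_le_iff_of_nonneg hsum]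
  intro k
  rw [Real.norm_eq_abs, abs_of_nonneg (hx k)]
  exact Finset.single_le_sum (fun k _ => hx k) (Finset.mem_univ k)

end Moments

lemma EquivWith.mono {C C' : ℝ≥0} {X Y : ℝ≥0∞} (h : EquivWith C X Y) (hC : C ≤ C') :
    EquivWith C' X Y :=
  ⟨h.1.trans (by gcongr), h.2.trans (by gcongr)⟩

variable {Φ : ℝ → ℝ} {A : ℝ} {n : ℕ} {f : Fin n → ℝ → ℝ}

/-- The common constant of the upper estimates. -/
noncomputable def upperConst (A : ℝ) : ℝ :=
  A * Real.exp 2 * (A * Real.exp 3) * (1 + A * Real.exp 2) ^ 2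

/-- Common end of both upper estimates: `Φ r` splits into multiples of `Φ (μ(1, g))` and `Φ N`, and
the former is below the rearrangement term because `μ` decreases on `(0,1)`. -/
lemma lintegral_sum_le_of_radius (h : IsOrlicz Φ) (hA0 : 0 ≤ A)
    (hA : ∀ t : ℝ, 0 ≤ t → ∀ s, Φ (t * s) ≤ A * Real.exp t * Φ s)
    {ν : Fin n → Measure ℝ} [∀ k, IsProbabilityMeasure (ν k)] {g : ℝ → ℝ}
    (hd : ∀ u : ℝ, 0 ≤ u → halfLineMeasure {s | u < |g s|} = (∑ k, ν k) {x | u < |x|})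
    {r N : ℝ} (har : rearrangement g 1 ≤ r) (hrN : r ≤ 2 * rearrangement g 1 + N)
    (hexp : 0 < rearrangement g 1 →
      ∫⁻ x, ENNReal.ofReal (Real.exp |∑ k, r⁻¹ * small (rearrangement g 1) (x k)|)
        ∂Measure.pi ν ≤ ENNReal.ofReal (Real.exp 3)) :
    ∫⁻ x, ENNReal.ofReal (Φ (∑ k, x k)) ∂Measure.pi ν ≤
      ENNReal.ofReal (upperConst A) * (phiMoment Φ (rearrangement g) + ENNReal.ofReal (Φ N)) := by
  set a := rearrangement g 1
  set M := phiMoment Φ (rearrangement g)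
  have ha0 : 0 ≤ a := rearrangement_nonneg g 1
  set D := A * Real.exp 2 with hD
  have hD0 : 0 ≤ D := by positivity
  have hr : Φ r ≤ D * D * Φ a + D * Φ N := by
    calc Φ r ≤ Φ (2 * a + N) := h.mono (by
          rw [abs_of_nonneg (ha0.trans har)]; exact hrN.trans (le_abs_self _))
      _ ≤ D * (Φ (2 * a) + Φ N) := h.map_add_le hA _ _
      _ ≤ D * (D * Φ a + Φ N) := by
          gcongr
          exact hA 2 zero_le_two a
      _ = _ := by ring
  have hr' : ENNReal.ofReal (Φ r) ≤
      ENNReal.ofReal (D * D) * M + ENNReal.ofReal D * ENNReal.ofReal (Φ N) := by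
    refine (ENNReal.ofReal_le_ofReal hr).trans ?_
    rw [ENNReal.ofReal_add (mul_nonneg (by positivity) (h.nonneg _))
      (mul_nonneg hD0 (h.nonneg _)), ENNReal.ofReal_mul (p := D * D) (by positivity),
      ENNReal.ofReal_mul (q := Φ N) hD0]
    gcongr
    exact map_rearrangement_one_le h hd
  calc _ ≤ ENNReal.ofReal (D * (A * Real.exp 3)) *
        (∫⁻ y, ENNReal.ofReal (Φ (large a y)) ∂(∑ k, ν k) + ENNReal.ofReal (Φ r)) :=
        lintegral_map_sum_le h hA0 hA ha0 har (tail_rearrangement_one_le hd) hexp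
    _ ≤ ENNReal.ofReal (D * (A * Real.exp 3)) *
        (M + (ENNReal.ofReal (D * D) * M + ENNReal.ofReal D * ENNReal.ofReal (Φ N))) := by
        gcongr
        exact lintegral_large_le h hd
    _ ≤ ENNReal.ofReal (D * (A * Real.exp 3)) *
        (ENNReal.ofReal ((1 + D) ^ 2) * (M + ENNReal.ofReal (Φ N))) := by
        have e1 : ENNReal.ofReal ((1 + D) ^ 2) = 1 + 2 * ENNReal.ofReal D + ENNReal.ofReal (D * D) := by
          rw [← ENNReal.ofReal_ofNat 2, ← ENNReal.ofReal_mul zero_le_two, ← ENNReal.ofReal_one,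
            ← ENNReal.ofReal_add zero_le_one (by positivity),
            ← ENNReal.ofReal_add (by positivity) (by positivity)]
          ring_nf
        gcongr
        rw [e1]
        calc M + (ENNReal.ofReal (D * D) * M + ENNReal.ofReal D * ENNReal.ofReal (Φ N))
            ≤ (M + (ENNReal.ofReal (D * D) * M + ENNReal.ofReal D * ENNReal.ofReal (Φ N))) +
              (2 * ENNReal.ofReal D * M + (1 + ENNReal.ofReal D + ENNReal.ofReal (D * D)) *
                ENNReal.ofReal (Φ N)) := le_self_add
          _ = _ := by ring
    _ = _ := by
        rw [← mul_assoc, ← ENNReal.ofReal_mul (by positivity), upperConst]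

lemma equivWith_of_nonneg (h : IsOrlicz Φ) (hA0 : 0 ≤ A)
    (hA : ∀ t : ℝ, 0 ≤ t → ∀ s, Φ (t * s) ≤ A * Real.exp t * Φ s)
    (hint : ∀ k, Integrable (f k) unitMeasure) (hind : iIndepFun f unitMeasure)
    (hnn : ∀ k, ∀ᵐ s ∂unitMeasure, 0 ≤ f k s) :
    EquivWith (upperConst A + 3).toNNReal (phiMoment Φ (fun s => ∑ k, f k s))
      (phiMoment Φ ((Ioo (0 : ℝ) 1).indicator (rearrangement (disjointSum f))) +
        extend Φ (eLpNorm (disjointSum f) 1 halfLineMeasure)) := by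
  have hf : ∀ k, AEMeasurable (f k) unitMeasure := fun k => (hint k).aestronglyMeasurable.aemeasurable
  have hd := fun u (hu : 0 ≤ u) => halfLineMeasure_lt_abs_disjointSum hf hu
  rw [phiMoment_sum_eq h hf hind, phiMoment_indicator]
  set ν := fun k => unitMeasure.map (f k)
  have hprob : ∀ k, IsProbabilityMeasure (ν k) := fun k => Measure.isProbabilityMeasure_map (hf k)
  have hintν : ∀ k, Integrable (fun y => y) (ν k) := fun k =>
    (integrable_map_measure (by fun_prop) (hf k)).2 (hint k)
  have hnnν : ∀ k, ∀ᵐ y ∂ν k, 0 ≤ y := fun k =>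
    (ae_map_iff (hf k) measurableSet_Ici).2 (hnn k)
  set m := ∑ k, ∫ y, |y| ∂ν k with hm
  have hm0 : 0 ≤ m := Finset.sum_nonneg fun k _ => integral_nonneg fun _ => abs_nonneg _
  have hnorm : eLpNorm (disjointSum f) 1 halfLineMeasure = ENNReal.ofReal m := by
    rw [hm, ENNReal.ofReal_sum_of_nonneg fun k _ => integral_nonneg fun _ => abs_nonneg _]
    refine (eLpNorm_one_disjointSum hf measurable_id rfl).trans ?_
    rw [lintegral_finsetSum_measure]
    exact Finset.sum_congr rfl fun k _ =>
      (ofReal_integral_eq_lintegral_ofReal (hintν k).abs (.of_forall fun _ => abs_nonneg _)).symm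
  rw [hnorm, extend_ofReal Φ hm0]
  have hU : 0 ≤ upperConst A := by unfold upperConst; positivity
  have ha0 := rearrangement_nonneg (disjointSum f) 1
  constructor
  · refine (lintegral_sum_le_of_radius h hA0 hA hd (N := m) (le_add_of_nonneg_right hm0)
      (by linarith) fun ha => lintegral_exp_small_le_of_integrable hintν ha).trans ?_
    gcongr
    exact ENNReal.ofReal_le_ofReal (by linarith)
  · set E := ∫⁻ x, ENNReal.ofReal (Φ (∑ k, x k)) ∂Measure.pi ν
    have h1 : phiMoment Φ (rearrangement (disjointSum f)) ≤ 2 * E :=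
      (phiMoment_rearrangement_le h hd).trans
        (mul_le_mul_right (lintegral_map_norm_le_of_nonneg h hnnν) 2)
    calc _ ≤ 2 * E + E := add_le_add h1 (map_sum_integral_abs_le_of_nonneg h hintν hnnν)
      _ = ENNReal.ofReal 3 * E := by rw [ENNReal.ofReal_ofNat]; ring
      _ ≤ _ := by
          gcongr
          exact ENNReal.ofReal_le_ofReal (by linarith)

/-- The constant in `sumNorm_le_of_symm`. -/
noncomputable def sumNormConst : ℝ := 4 + 384 * Real.exp 3

/-- Truncation at `μ(1, f)` is a good enough decomposition. The lower estimates for the Orlicz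
function `|t|` bound the large part and the level by `2 * E` each; the small part uses
`sqrt_sum_small_sq_le`. -/
lemma sumNorm_le_of_symm (hf : ∀ k, AEMeasurable (f k) unitMeasure)
    (hs : ∀ k, (unitMeasure.map (f k)).map (fun y => -y) = unitMeasure.map (f k)) :
    sumNorm (disjointSum f) halfLineMeasure ≤ ENNReal.ofReal sumNormConst *
      ∫⁻ x, ENNReal.ofReal |∑ k, x k| ∂Measure.pi fun k => unitMeasure.map (f k) := by
  have hd := fun u (hu : 0 ≤ u) => halfLineMeasure_lt_abs_disjointSum hf hu
  set ν := fun k => unitMeasure.map (f k)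
  have hprob : ∀ k, IsProbabilityMeasure (ν k) := fun k => Measure.isProbabilityMeasure_map (hf k)
  set E := ∫⁻ x, ENNReal.ofReal |∑ k, x k| ∂Measure.pi ν
  set a := rearrangement (disjointSum f) 1
  have ha0 : 0 ≤ a := rearrangement_nonneg _ _
  have hM : phiMoment (fun t => |t|) (rearrangement (disjointSum f)) ≤ 2 * E :=
    (phiMoment_rearrangement_le isOrlicz_abs hd).trans
      (mul_le_mul_right (lintegral_map_norm_le isOrlicz_abs hs) 2)
  have hlarge : eLpNorm (fun t => large a (disjointSum f t)) 1 halfLineMeasure ≤ 2 * E := by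
    rw [eLpNorm_one_disjointSum hf (measurable_large a) (by simp [large])]
    exact (lintegral_large_le isOrlicz_abs hd).trans hM
  have ha : ENNReal.ofReal a ≤ 2 * E := by
    have := (map_rearrangement_one_le isOrlicz_abs hd).trans hM
    rwa [abs_of_nonneg (rearrangement_nonneg _ _)] at this
  have hH : ENNReal.ofReal (∫ x, |∑ k, small a (x k)| ∂Measure.pi ν) ≤ E := by
    rw [ofReal_integral_eq_lintegral_ofReal _ (.of_forall fun _ => abs_nonneg _)]
    · exact lintegral_map_sum_small_le isOrlicz_abs hs a
    · have hm : Measurable fun x : Fin n → ℝ => |∑ k, small a (x k)| := by fun_prop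
      refine .of_bound hm.aestronglyMeasurable (n * a) (.of_forall fun x => ?_)
      rw [Real.norm_eq_abs, abs_abs]
      exact (Finset.abs_sum_le_sum_abs _ _).trans
        ((Finset.sum_le_card_nsmul _ _ a fun k _ => abs_small_le ha0 (x k)).trans (by simp))
  have hsmall : eLpNorm (fun t => small a (disjointSum f t)) 2 halfLineMeasure ≤
      2 * E + ENNReal.ofReal (384 * Real.exp 3) * E := by
    rw [eLpNorm_two_small_disjointSum hf ha0]
    refine (ENNReal.ofReal_le_ofReal (sqrt_sum_small_sq_le hs ha0)).trans ?_
    rw [ENNReal.ofReal_add ha0 (mul_nonneg (by positivity)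
      (integral_nonneg fun _ => abs_nonneg _)), ENNReal.ofReal_mul (p := 384 * Real.exp 3)
      (by positivity)]
    gcongr
  calc _ ≤ _ := sumNorm_le_large_add_small (aemeasurable_disjointSum hf) a
    _ ≤ 2 * E + (2 * E + ENNReal.ofReal (384 * Real.exp 3) * E) := add_le_add hlarge hsmall
    _ = _ := by
        rw [sumNormConst, ENNReal.ofReal_add (by norm_num) (by positivity), ENNReal.ofReal_ofNat]
        ring

lemma equivWith_of_symm (h : IsOrlicz Φ) (hA0 : 0 ≤ A)
    (hA : ∀ t : ℝ, 0 ≤ t → ∀ s, Φ (t * s) ≤ A * Real.exp t * Φ s)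
    (hint : ∀ k, Integrable (f k) unitMeasure) (hind : iIndepFun f unitMeasure)
    (hsym : ∀ k, IdentDistrib (f k) (fun s => -f k s) unitMeasure unitMeasure) :
    EquivWith (upperConst A + (2 + A * Real.exp sumNormConst)).toNNReal
      (phiMoment Φ (fun s => ∑ k, f k s))
      (phiMoment Φ ((Ioo (0 : ℝ) 1).indicator (rearrangement (disjointSum f))) +
        extend Φ (sumNorm (disjointSum f) halfLineMeasure)) := by
  have hf : ∀ k, AEMeasurable (f k) unitMeasure := fun k => (hint k).aestronglyMeasurable.aemeasurable
  have hs : ∀ k, (unitMeasure.map (f k)).map (fun y => -y) = unitMeasure.map (f k) := fun k => by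
    rw [AEMeasurable.map_map_of_aemeasurable (by fun_prop) (hf k)]
    exact (hsym k).map_eq.symm
  have hd := fun u (hu : 0 ≤ u) => halfLineMeasure_lt_abs_disjointSum hf hu
  have hle := sumNorm_le_of_symm hf hs
  rw [phiMoment_sum_eq h hf hind, phiMoment_indicator]
  set ν := fun k => unitMeasure.map (f k) with hν
  have hprob : ∀ k, IsProbabilityMeasure (ν k) := fun k => Measure.isProbabilityMeasure_map (hf k)
  have hintν : ∀ k, Integrable (fun y => y) (ν k) := fun k =>
    (integrable_map_measure (by fun_prop) (hf k)).2 (hint k)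
  have hiS := (integrable_sum_pi hintν).abs
  set a := rearrangement (disjointSum f) 1
  have ha0 : 0 ≤ a := rearrangement_nonneg _ _
  set e := ∫ x, |∑ k, x k| ∂Measure.pi ν with he
  have he0 : 0 ≤ e := integral_nonneg fun _ => abs_nonneg _
  have hc0 : 0 ≤ sumNormConst := by unfold sumNormConst; positivity
  rw [← ofReal_integral_eq_lintegral_ofReal hiS (.of_forall fun _ => abs_nonneg _), ← he,
    ← ENNReal.ofReal_mul hc0] at hle
  set N := (sumNorm (disjointSum f) halfLineMeasure).toReal with hN
  have hNt : sumNorm (disjointSum f) halfLineMeasure = ENNReal.ofReal N :=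
    (ENNReal.ofReal_toReal (ne_top_of_le_ne_top ENNReal.ofReal_ne_top hle)).symm
  have hN0 : 0 ≤ N := ENNReal.toReal_nonneg
  have hNe : N ≤ sumNormConst * e := by
    rw [hNt] at hle
    exact (ENNReal.ofReal_le_ofReal_iff (by positivity)).1 hle
  have hσ : √(∑ k, ∫ y, small a y ^ 2 ∂ν k) ≤ a + N := by
    have := eLpNorm_small_le_add_sumNorm (ρ := halfLineMeasure) (disjointSum f) ha0
    rw [eLpNorm_two_small_disjointSum hf ha0, hNt, ← ENNReal.ofReal_add ha0 hN0] at this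
    exact (ENNReal.ofReal_le_ofReal_iff (by positivity)).1 this
  rw [hNt, extend_ofReal Φ hN0]
  have hU : 0 ≤ upperConst A := by unfold upperConst; positivity
  have hA' : 0 ≤ A * Real.exp sumNormConst := by positivity
  constructor
  · refine (lintegral_sum_le_of_radius h hA0 hA hd (N := N)
      (le_add_of_nonneg_right (Real.sqrt_nonneg _)) (by linarith)
      fun ha => lintegral_exp_small_le_of_symm hs ha).trans ?_
    gcongr
    exact ENNReal.ofReal_le_ofReal (by linarith)
  · set E := ∫⁻ x, ENNReal.ofReal (Φ (∑ k, x k)) ∂Measure.pi ν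
    have h1 : phiMoment Φ (rearrangement (disjointSum f)) ≤ 2 * E :=
      (phiMoment_rearrangement_le h hd).trans (mul_le_mul_right (lintegral_map_norm_le h hs) 2)
    have h2 : ENNReal.ofReal (Φ e) ≤ E := by
      refine (h.jensen hiS).trans_eq ?_
      simp only [h.map_abs]
      rfl
    -- The growth bound moves the constant in `N ≤ sumNormConst * e` outside `Φ`.
    have h3 : ENNReal.ofReal (Φ N) ≤ ENNReal.ofReal (A * Real.exp sumNormConst) * E := by
      calc ENNReal.ofReal (Φ N) ≤ ENNReal.ofReal (A * Real.exp sumNormConst * Φ e) :=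
            ENNReal.ofReal_le_ofReal ((h.mono (by
              rwa [abs_of_nonneg hN0, abs_of_nonneg (by positivity)])).trans (hA _ hc0 e))
        _ ≤ _ := by
            rw [ENNReal.ofReal_mul hA']
            gcongr
    calc _ ≤ 2 * E + ENNReal.ofReal (A * Real.exp sumNormConst) * E := add_le_add h1 h3
      _ = ENNReal.ofReal (2 + A * Real.exp sumNormConst) * E := by
          rw [ENNReal.ofReal_add zero_le_two hA', ENNReal.ofReal_ofNat]; ring
      _ ≤ _ := by
          gcongr
          exact ENNReal.ofReal_le_ofReal (by linarith)

end PhiMoment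

theorem theorem1p3 (Φ : ℝ → ℝ) (hΦ : PhiMoment.IsOrlicz Φ) (hΔ : PhiMoment.DeltaTwo Φ) :
    ∃ C : ℝ≥0, ∀ (n : ℕ) (f : Fin n → ℝ → ℝ),
      (∀ k, PhiMoment.MemOrlicz Φ (f k) PhiMoment.unitMeasure) →
      iIndepFun f PhiMoment.unitMeasure →
      ((∀ k, ∀ᵐ s ∂PhiMoment.unitMeasure, 0 ≤ f k s) →
        PhiMoment.EquivWith C
          (PhiMoment.phiMoment Φ (fun s => ∑ k, f k s))
          (PhiMoment.phiMoment Φ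
              ((Ioo (0 : ℝ) 1).indicator (PhiMoment.rearrangement (PhiMoment.disjointSum f))) +
            PhiMoment.extend Φ
              (eLpNorm (PhiMoment.disjointSum f) 1 PhiMoment.halfLineMeasure))) ∧
      ((∀ k, IdentDistrib (f k) (fun s => -f k s)
            PhiMoment.unitMeasure PhiMoment.unitMeasure) →
        PhiMoment.EquivWith C
          (PhiMoment.phiMoment Φ (fun s => ∑ k, f k s))
          (PhiMoment.phiMoment Φ
              ((Ioo (0 : ℝ) 1).indicator (PhiMoment.rearrangement (PhiMoment.disjointSum f))) +
            PhiMoment.extend Φ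
              (PhiMoment.sumNorm (PhiMoment.disjointSum f) PhiMoment.halfLineMeasure))) := by

  obtain ⟨A, hA0, hA⟩ := hΦ.exists_growth hΔ
  by_cases hne : ∃ x, 0 < Φ x
  · refine ⟨(PhiMoment.upperConst A + 3).toNNReal ⊔
      (PhiMoment.upperConst A + (2 + A * Real.exp PhiMoment.sumNormConst)).toNNReal,
      fun n f hf hind => ?_⟩
    have hint := fun k => (hf k).integrable hΦ hne
    exact ⟨fun hnn => (PhiMoment.equivWith_of_nonneg hΦ hA0 hA hint hind hnn).mono le_sup_left,
      fun hs => (PhiMoment.equivWith_of_symm hΦ hA0 hA hint hind hs).mono le_sup_right⟩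
  -- If `Φ` vanishes, integrability may fail and the norms may be infinite, but `extend` still gives
  -- `0`.
  · have hz : ∀ x, Φ x = 0 := fun x => le_antisymm (not_lt.1 fun hx => hne ⟨x, hx⟩) (hΦ.nonneg x)
    exact ⟨0, fun n f _ _ => ⟨fun _ => by
      simp [PhiMoment.EquivWith, PhiMoment.phiMoment, PhiMoment.extend, hz], fun _ => by
      simp [PhiMoment.EquivWith, PhiMoment.phiMoment, PhiMoment.extend, hz]⟩⟩
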